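/- Let $k$ be a field, let $R=k[X_1,\dots,X_n]$ be the standard graded polynomial ring with graded maximal ideal $\mathfrak m=(X_1,\dots,X_n)$, and identify $k$ with $R/\mathfrak m$. Let $M=\bigoplus_{t\in\mathbb Z}M_t$ be a finitely generated graded $R$-module of Krull dimension $d$, and let $P_M\in\mathbb Q[t]$ be its Hilbert polynomial, so that $P_M(t)=\dim_k M_t$ for all $t\gg 0$. Let $\operatorname{indeg}(M)=\min\{t : M_t\neq 0\}$ be the initial degree of $M$, and let $\operatorname{reg}(M)=\max\{j-i : \operatorname{Tor}_i^R(M,k)_j\neq 0\}$ be its Castelnuovo–Mumford regularity; equivalently, $\operatorname{reg}(M)$ is the maximum of $a-i$ over all $i$ and all degrees $a$ of the generators of the $i$-th module in the minimal graded free resolution of $M$. (For $M=0$ one has $\operatorname{indeg}(M)=+\infty$ and $\operatorname{reg}(M)=-\infty$.) Suppose that $\operatorname{reg}(M)=\operatorname{indeg}(M)=r$ for an integer $r$, and that $$H^0_{\mathfrak m}(M)=\{x\in M : \mathfrak m^t x=0 \text{ for some } t\ge 0\}=0 .$$ For a polynomial $P$ put $\Delta P(t)=P(t)-P(t-1)$,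 $\Delta^0P=P$ and $\Delta^{\ell}P=\Delta(\Delta^{\ell-1}P)$, and let $\binom ab=0$ for integers $0\le a<b$. Then, for every integer $i\ge 0$, the vector space $\operatorname{Tor}_i^R(M,k)$ is finite dimensional and $$\dim_k \operatorname{Tor}_i^R(M,k)=\sum_{\ell=0}^{\min\{i,d-1\}}(-1)^{\ell}\binom{n-\ell-1}{i-\ell}\,\Delta^{\ell}P_M(r+\ell).$$ -/

import Mathlib

universe u

namespace LinearResolution

open MvPolynomial

section Definitions

variable {k : Type u} [Field k] {n : ℕ}
variable {M : Type u} [AddCommGroup M] [Module (MvPolynomial (Fin n) k) M] [Module k M]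

/-- The graded maximal ideal `𝔪 = (X₁, …, Xₙ)` of `R = k[X₁, …, Xₙ]`. -/
noncomputable def maxIdeal (k : Type u) [Field k] (n : ℕ) : Ideal (MvPolynomial (Fin n) k) :=
  Ideal.span (Set.range X)

/-- `M = ⨁ₜ Mₜ` is a `ℤ`-graded module over the standard graded polynomial ring:
the family of `k`-subspaces `𝓜 t` is a direct sum decomposition of `M`, and the product of a form
of degree `e` with an element of `Mₜ` lies in `Mₜ₊ₑ`. -/
structure IsGradedModule (𝓜 : ℤ → Submodule k M) : Prop where
  isInternal : DirectSum.IsInternal 𝓜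
  smul_mem : ∀ (e : ℕ) (t : ℤ) (p : MvPolynomial (Fin n) k) (x : M),
    p ∈ homogeneousSubmodule (Fin n) k e → x ∈ 𝓜 t → p • x ∈ 𝓜 (t + e)

/-- `p` is zero or a form of degree `e`, where `e` is an integer (so `p = 0` if `e < 0`). -/
def IsFormOfDegree (p : MvPolynomial (Fin n) k) (e : ℤ) : Prop :=
  ∀ c : Fin n →₀ ℕ, coeff c p ≠ 0 → (c.degree : ℤ) = e

/-- A minimal graded free resolution
`⋯ → F₂ → F₁ → F₀ → M → 0` with `Fᵢ = ⨁ₛ R(-deg i s)`, a free module of finite rank.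
All maps are homogeneous of degree zero, and minimality says that the entries of the matrices of
the differentials lie in the maximal ideal `𝔪` (their constant terms vanish). -/
structure MinimalGradedFreeResolution (𝓜 : ℤ → Submodule k M) where
  rank : ℕ → ℕ
  deg : (i : ℕ) → Fin (rank i) → ℤ
  ε : (Fin (rank 0) → MvPolynomial (Fin n) k) →ₗ[MvPolynomial (Fin n) k] M
  d : (i : ℕ) → (Fin (rank (i + 1)) → MvPolynomial (Fin n) k) →ₗ[MvPolynomial (Fin n) k]
    (Fin (rank i) → MvPolynomial (Fin n) k)
  ε_mem : ∀ s, ε (Pi.single s 1) ∈ 𝓜 (deg 0 s)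
  d_form : ∀ i s t, IsFormOfDegree (d i (Pi.single s 1) t) (deg (i + 1) s - deg i t)
  ε_surjective : Function.Surjective ε
  exact_zero : Function.Exact (d 0) ε
  exact_succ : ∀ i, Function.Exact (d (i + 1)) (d i)
  minimal : ∀ i s t, constantCoeff (d i (Pi.single s 1) t) = 0

variable (n) in
/-- `reg M = r` for an integer `r` (Castelnuovo–Mumford regularity):
`r` is the maximum of `a - i` over all `i` and all degrees `a` of generators of the `i`-th module
of the minimal graded free resolution of `M`; these `a` are the degrees in which
`Torᵢ(M, k)` does not vanish. For `M = 0` no integer `r` qualifies, as `reg 0 = -∞`. -/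
def HasRegularity (𝓜 : ℤ → Submodule k M) (r : ℤ) : Prop :=
  ∃ F : MinimalGradedFreeResolution (n := n) 𝓜,
    IsGreatest {m : ℤ | ∃ (i : ℕ) (s : Fin (F.rank i)), m = F.deg i s - i} r

/-- `indeg M = r` for an integer `r`: the least degree in which `M` is non-zero.
For `M = 0` no integer `r` qualifies, as `indeg 0 = +∞`. -/
def HasInitialDegree {M : Type u} [AddCommGroup M] [Module k M]
    (𝓜 : ℤ → Submodule k M) (r : ℤ) : Prop :=
  IsLeast {t : ℤ | 𝓜 t ≠ ⊥} r


/-- `H⁰_𝔪(M) = ⋃ₜ (0 :_M 𝔪ᵗ)`, the submodule of elements killed by a power of `𝔪`. -/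
noncomputable def zerothLocalCohomology (k : Type u) [Field k] (n : ℕ) (M : Type u) [AddCommGroup M] [Module (MvPolynomial (Fin n) k) M] :
    Submodule (MvPolynomial (Fin n) k) M :=
  ⨆ t : ℕ, Submodule.torsionBySet (MvPolynomial (Fin n) k) M
    ((maxIdeal k n ^ t : Ideal (MvPolynomial (Fin n) k)) : Set (MvPolynomial (Fin n) k))

/-- The Hilbert function `H_M(t) = dim_k Mₜ`. -/
noncomputable def hilbertFunction {M : Type u} [AddCommGroup M] [Module k M]
    (𝓜 : ℤ → Submodule k M) (t : ℤ) : ℕ :=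
  Module.finrank k (𝓜 t)

/-- `P` is the Hilbert polynomial of `M`: it agrees with the Hilbert function in all large
degrees. There is at most one such `P`. -/
def IsHilbertPolynomial {M : Type u} [AddCommGroup M] [Module k M]
    (𝓜 : ℤ → Submodule k M) (P : Polynomial ℚ) : Prop :=
  ∀ᶠ t : ℤ in Filter.atTop, P.eval (t : ℚ) = (hilbertFunction 𝓜 t : ℚ)

open Classical in
/-- The Hilbert polynomial `P_M` (it exists for every finitely generated graded module). -/
noncomputable def hilbertPolynomial {M : Type u} [AddCommGroup M] [Module k M]
    (𝓜 : ℤ → Submodule k M) : Polynomial ℚ :=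
  if h : ∃ P, IsHilbertPolynomial 𝓜 P then h.choose else 0

/-- The backward difference `ΔP(t) = P(t) - P(t - 1)`. -/
noncomputable def backwardDiff (P : Polynomial ℚ) : Polynomial ℚ :=
  P - P.comp (Polynomial.X - 1)

/-- `Torᵢ^R(M, k)` with `R = k[X₁, …, Xₙ]` and `k = R/𝔪`: the `i`-th left derived functor of
`- ⊗_R k`, evaluated at `M` and regarded as a `k`-vector space. -/
noncomputable abbrev torResidueField (k : Type u) [Field k] (n : ℕ) (M : Type u) [AddCommGroup M]
    [Module (MvPolynomial (Fin n) k) M] (i : ℕ) : ModuleCat.{u} k :=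
  (ModuleCat.restrictScalars (algebraMap k (MvPolynomial (Fin n) k))).obj
    (((CategoryTheory.Tor' (ModuleCat.{u} (MvPolynomial (Fin n) k)) i).obj
      (ModuleCat.of (MvPolynomial (Fin n) k) M)).obj
        (ModuleCat.of (MvPolynomial (Fin n) k) (MvPolynomial (Fin n) k ⧸ maxIdeal k n)))

end Definitions

end LinearResolution

/-! Write `β i` for the rank of the `i`-th module of a minimal resolution `F`. Minimality kills the
differentials after tensoring with the residue field, so the Tor dimension is `β i`. Equality of
regularity and initial degree forces every generator of the `i`-th module into degree `r + i`: the
resolution is linear (`deg_eq`). The Hilbert series of `M`, shifted by `r`, is then `Q / (1 - t)^n`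
with `Q = ∑ (-1)^i β i t^i`, so no cancellation between Betti numbers occurs and they can be read
off `Q`.

Two bounds on `Q` are needed. Vanishing of `H⁰_𝔪(M)` gives `deg Q < n` (`IsLinear.rank_eq_zero`):
the linear differential is `∑ X j ∂ j` with anticommuting `∂ j` of square zero, and a nonzero
constant vector in homological degree at least `n` would be carried by all the `∂ j` in succession
to a nonzero socle element of `M`. The dimension gives `(1 - t)^(n - d) ∣ Q`: Noether normalization
bounds the partial sums of the Hilbert function by a polynomial of degree at most `d`
(`IsLinear.exists_sum_hilbertFunction_le`).

Hence the series is `Q' / (1 - t)^d` with `deg Q' < d`, which means that the Hilbert function equals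
`P_M` in every degree from `r` on. Newton's expansion of `P_M` at `r`, with `∑ C(j, l) t^j = t^l /
(1 - t)^(l + 1)`, yields `Q = ∑ Δ^l P_M(r + l) t^l (1 - t)^(n - l - 1)`; the coefficient of `t^i` is
the formula (`betti_eq_of_hilbertFunction`). -/

namespace LinearResolution
open MvPolynomial CategoryTheory
open scoped TensorProduct

/-! ### Betti numbers as Tor dimensions -/

section Tor
variable {k : Type u} [Field k] {n : ℕ}
variable {M : Type u} [AddCommGroup M] [Module (MvPolynomial (Fin n) k) M] [Module k M]
variable {𝓜 : ℤ → Submodule k M}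

/-- The chain complex of a minimal graded free resolution. -/
noncomputable def MinimalGradedFreeResolution.complex (F : MinimalGradedFreeResolution (n := n) 𝓜) :
    ChainComplex (ModuleCat.{u} (MvPolynomial (Fin n) k)) ℕ :=
  ChainComplex.of (fun i => ModuleCat.of _ (Fin (F.rank i) → MvPolynomial (Fin n) k))
    (fun i => ModuleCat.ofHom (F.d i)) (fun i => by
      rw [← ModuleCat.ofHom_comp, (F.exact_succ i).linearMap_comp_eq_zero]; rfl)

lemma MinimalGradedFreeResolution.complex_d (F : MinimalGradedFreeResolution (n := n) 𝓜) (i : ℕ) :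
    F.complex.d (i + 1) i = ModuleCat.ofHom (F.d i) :=
  ChainComplex.of_d (fun i => ModuleCat.of _ (Fin (F.rank i) → MvPolynomial (Fin n) k))
    (fun i => ModuleCat.ofHom (F.d i)) i

/-- A minimal graded free resolution is a projective resolution of the module. -/
noncomputable def MinimalGradedFreeResolution.projectiveResolution
    (F : MinimalGradedFreeResolution (n := n) 𝓜) :
    ProjectiveResolution (ModuleCat.of (MvPolynomial (Fin n) k) M) where
  complex := F.complex
  projective i := by
    change Projective (ModuleCat.of _ (Fin (F.rank i) → MvPolynomial (Fin n) k))
    infer_instance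
  π := (ChainComplex.toSingle₀Equiv _ _).symm ⟨ModuleCat.ofHom F.ε, by
    rw [F.complex_d]
    exact (ModuleCat.ofHom_comp _ _).symm.trans (by rw [F.exact_zero.linearMap_comp_eq_zero]; rfl)⟩
  -- In degree 0 this is exactness at the zeroth free module with surjectivity of `ε`; in higher
  -- degrees the target is zero and only exactness remains.
  quasiIso := ⟨fun i => by
    cases i
    · rw [ChainComplex.quasiIsoAt₀_iff, ShortComplex.quasiIso_iff_of_zeros']
      · refine (ShortComplex.exact_and_epi_g_iff_of_iso (S₂ := ShortComplex.mk
          (ModuleCat.ofHom (F.d 0)) (ModuleCat.ofHom F.ε)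
          (by rw [← ModuleCat.ofHom_comp, F.exact_zero.linearMap_comp_eq_zero]; rfl)) ?_).2 ⟨?_, ?_⟩
        · exact ShortComplex.isoMk (Iso.refl _) (Iso.refl _) (Iso.refl _)
            
            (by simp only [Iso.refl_hom, HomologicalComplex.shortComplexFunctor'_obj_f, F.complex_d]
                exact (Category.id_comp _).trans (Category.comp_id _).symm)
            (by simp only [Iso.refl_hom, HomologicalComplex.shortComplexFunctor'_map_τ₂]
                exact (Category.id_comp _).trans (Category.comp_id _).symm)
        · exact (ShortComplex.ShortExact.moduleCat_exact_iff_function_exact _).2 F.exact_zero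
        · exact (ModuleCat.epi_iff_surjective _).2 F.ε_surjective
      all_goals rfl
    · rw [quasiIsoAt_iff_exactAt']
      · rename_i j
        rw [HomologicalComplex.exactAt_iff' _ (j + 1 + 1) (j + 1) j (by simp) (by simp),
          ShortComplex.ShortExact.moduleCat_exact_iff_function_exact]
        change Function.Exact (F.complex.d (j + 1 + 1) (j + 1)) (F.complex.d (j + 1) j)
        rw [F.complex_d, F.complex_d]
        exact F.exact_succ j
      · apply ChainComplex.exactAt_succ_single_obj⟩


lemma maxIdeal_eq_ker : maxIdeal k n = RingHom.ker (constantCoeff (σ := Fin n) (R := k)) := by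
  ext p
  rw [maxIdeal, ← Set.image_univ, mem_ideal_span_X_image, RingHom.mem_ker, constantCoeff_eq]
  simp only [Set.mem_univ, true_and]
  refine ⟨fun h => ?_, fun h m hm => ?_⟩
  · by_contra h0
    obtain ⟨i, hi⟩ := h 0 (mem_support_iff.2 h0)
    exact hi rfl
  · by_contra! h0
    rw [Finsupp.ext (g := 0) h0] at hm
    exact mem_support_iff.1 hm h

/-- By minimality, the differentials take values in vectors without constant terms. -/
lemma MinimalGradedFreeResolution.constantCoeff_d (F : MinimalGradedFreeResolution (n := n) 𝓜)
    (i : ℕ) (x : Fin (F.rank (i + 1)) → MvPolynomial (Fin n) k) (t : Fin (F.rank i)) :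
    constantCoeff (F.d i x t) = 0 := by
  rw [LinearMap.pi_apply_eq_sum_univ (F.d i) x, Finset.sum_apply, map_sum]
  refine Finset.sum_eq_zero fun s _ => ?_
  have := F.minimal i s t
  rw [Pi.smul_apply, smul_eq_mul, map_mul]
  convert mul_zero _
  convert this using 4
  ext t
  simp [Pi.single_apply, eq_comm]

/-- The coordinates of `v` move across the tensor sign and annihilate `R ⧸ I`. -/
lemma tmul_eq_zero_of_mem {R : Type*} [CommRing R] {I : Ideal R} {m : ℕ} (v : Fin m → R)
    (hv : ∀ s, v s ∈ I) (y : R ⧸ I) : v ⊗ₜ[R] y = 0 := by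
  rw [pi_eq_sum_univ v, TensorProduct.sum_tmul]
  refine Finset.sum_eq_zero fun s _ => ?_
  obtain ⟨y, rfl⟩ := Ideal.Quotient.mk_surjective y
  rw [TensorProduct.smul_tmul, ← Ideal.Quotient.mk_eq_mk, ← Submodule.Quotient.mk_smul,
    smul_eq_mul, (Submodule.Quotient.mk_eq_zero I).2 (I.mul_mem_right _ (hv s)),
    TensorProduct.tmul_zero]

lemma MinimalGradedFreeResolution.map_complex_d_eq_zero
    (F : MinimalGradedFreeResolution (n := n) 𝓜) (i j : ℕ) :
    ((((MonoidalCategory.tensoringRight (ModuleCat.{u} (MvPolynomial (Fin n) k))).obj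
      (ModuleCat.of _ (MvPolynomial (Fin n) k ⧸ maxIdeal k n))).mapHomologicalComplex
        (ComplexShape.down ℕ)).obj F.complex).d i j = 0 := by
  by_cases h : j + 1 = i
  · subst h
    simp only [Functor.mapHomologicalComplex_obj_d, F.complex_d]
    refine ModuleCat.hom_ext (TensorProduct.ext' fun x y => ?_)
    refine (tmul_eq_zero_of_mem (F.d j x) (fun s => ?_) y :)
    rw [maxIdeal_eq_ker]
    exact F.constantCoeff_d j x s
  · exact HomologicalComplex.shape _ _ _ h

/-- Since the differentials vanish after tensoring with the residue field,
`Torᵢ(M, k) = Fᵢ ⊗ k`. -/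
noncomputable def MinimalGradedFreeResolution.torIso
    (F : MinimalGradedFreeResolution (n := n) 𝓜) (i : ℕ) :
    ((CategoryTheory.Tor' (ModuleCat.{u} (MvPolynomial (Fin n) k)) i).obj
      (ModuleCat.of (MvPolynomial (Fin n) k) M)).obj
        (ModuleCat.of (MvPolynomial (Fin n) k) (MvPolynomial (Fin n) k ⧸ maxIdeal k n)) ≅
    ModuleCat.of _ (TensorProduct (MvPolynomial (Fin n) k) (Fin (F.rank i) → MvPolynomial (Fin n) k)
      (MvPolynomial (Fin n) k ⧸ maxIdeal k n)) :=
  F.projectiveResolution.isoLeftDerivedObj _ i ≪≫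
    (ShortComplex.HomologyData.ofZeros _ (F.map_complex_d_eq_zero _ _)
      (F.map_complex_d_eq_zero _ _)).left.homologyIso

theorem MinimalGradedFreeResolution.finrank_torResidueField
    (F : MinimalGradedFreeResolution (n := n) 𝓜) (i : ℕ) :
    Module.Finite k (torResidueField k n M i) ∧
      Module.finrank k (torResidueField k n M i) = F.rank i := by
  let e := (F.torIso i).toLinearEquiv
  let e' := e.trans (TensorProduct.comm _ _ _ ≪≫ₗ TensorProduct.piScalarRight _ _ _ _)
  let f : (torResidueField k n M i) ≃ₗ[k]
    (Fin (F.rank i) → MvPolynomial (Fin n) k ⧸ maxIdeal k n) :=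
    { e' with
      map_smul' := fun c x => by
        refine (e'.map_smul (algebraMap k (MvPolynomial (Fin n) k) c) x).trans ?_
        ext s
        exact algebraMap_smul (MvPolynomial (Fin n) k) c (e' x s) }
  let a : MvPolynomial (Fin n) k →ₐ[k] k := MvPolynomial.aeval 0
  have ha : RingHom.ker a = maxIdeal k n := by
    rw [maxIdeal_eq_ker]
    ext p
    simp [a, RingHom.mem_ker]
  let g : (MvPolynomial (Fin n) k ⧸ maxIdeal k n) ≃ₗ[k] k :=
    ((Ideal.quotientEquivAlgOfEq k ha.symm).trans (Ideal.quotientKerAlgEquivOfSurjective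
      (f := a) fun c => ⟨C c, by simp [a]⟩)).toLinearEquiv
  let e₂ := f.trans (LinearEquiv.piCongrRight fun _ => g)
  exact ⟨Module.Finite.equiv e₂.symm, by simp [e₂.finrank_eq]⟩

end Tor
end LinearResolution

/-! ### Linearity of the resolution and the operators `∂ j` -/

namespace LinearResolution
open MvPolynomial

section LinearStrand
variable {k : Type u} [Field k] {n : ℕ}
variable {M : Type u} [AddCommGroup M] [Module (MvPolynomial (Fin n) k) M] [Module k M]
variable {𝓜 : ℤ → Submodule k M}

namespace MinimalGradedFreeResolution

/-- By exactness a cycle is a boundary, and boundaries have no constant terms. Thus `d` is injective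
on constant vectors, the form in which minimality is used from here on. -/
lemma constantCoeff_of_d_eq_zero (F : MinimalGradedFreeResolution (n := n) 𝓜) {i : ℕ}
    {x : Fin (F.rank (i + 1)) → MvPolynomial (Fin n) k} (hx : F.d i x = 0)
    (s : Fin (F.rank (i + 1))) : constantCoeff (x s) = 0 := by
  obtain ⟨y, rfl⟩ := (F.exact_succ i x).1 hx
  exact F.constantCoeff_d _ y s

lemma constantCoeff_of_ε_eq_zero (F : MinimalGradedFreeResolution (n := n) 𝓜)
    {x : Fin (F.rank 0) → MvPolynomial (Fin n) k} (hx : F.ε x = 0)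
    (s : Fin (F.rank 0)) : constantCoeff (x s) = 0 := by
  obtain ⟨y, rfl⟩ := (F.exact_zero x).1 hx
  exact F.constantCoeff_d _ y s

lemma ε_single_ne_zero (F : MinimalGradedFreeResolution (n := n) 𝓜) (s : Fin (F.rank 0)) :
    F.ε (Pi.single s 1) ≠ 0 := fun h => by
  simpa using F.constantCoeff_of_ε_eq_zero h s

lemma d_single_ne_zero (F : MinimalGradedFreeResolution (n := n) 𝓜) (i : ℕ)
    (s : Fin (F.rank (i + 1))) : F.d i (Pi.single s 1) ≠ 0 := fun h => by
  simpa using F.constantCoeff_of_d_eq_zero h s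

/-- In a minimal resolution of a module generated in degrees `≥ r`, the generators of `Fᵢ` have
degrees `≥ r + i`. -/
lemma le_deg (F : MinimalGradedFreeResolution (n := n) 𝓜) {r : ℤ}
    (hr : HasInitialDegree 𝓜 r) (i : ℕ) (s : Fin (F.rank i)) : r + i ≤ F.deg i s := by
  induction i with
  | zero =>
    simp only [Nat.cast_zero, add_zero]
    refine hr.2 fun h => F.ε_single_ne_zero s ?_
    have := F.ε_mem s
    rwa [h, Submodule.mem_bot] at this
  | succ i ih =>
    -- A nonzero entry in the column of the generator has no constant term, hence positive degree,
    -- so the generator lies strictly above some generator one step earlier.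
    obtain ⟨t, ht⟩ := Function.ne_iff.1 (F.d_single_ne_zero i s)
    obtain ⟨c, hc⟩ := MvPolynomial.ne_zero_iff.1 ht
    have h1 := F.d_form i s t c hc
    have h2 : c ≠ 0 := by
      rintro rfl
      exact hc (F.minimal i s t)
    have h3 : 0 < c.degree := Nat.pos_of_ne_zero (by simpa [Finsupp.degree_eq_zero_iff] using h2)
    have := ih t
    push_cast
    omega

/-- The initial degree bounds the degrees from below and the regularity from above. -/
lemma deg_eq (F : MinimalGradedFreeResolution (n := n) 𝓜) {r : ℤ}
    (hr : HasInitialDegree 𝓜 r)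
    (hF : IsGreatest {m : ℤ | ∃ (i : ℕ) (s : Fin (F.rank i)), m = F.deg i s - i} r)
    (i : ℕ) (s : Fin (F.rank i)) : F.deg i s = r + i := by
  have h1 := F.le_deg hr i s
  have h2 := hF.2 ⟨i, s, rfl⟩
  omega

/-- The resolution is linear: `Fᵢ = R(-r-i)^{rank i}`. -/
def IsLinear (F : MinimalGradedFreeResolution (n := n) 𝓜) (r : ℤ) : Prop :=
  ∀ i s, F.deg i s = r + i

lemma IsLinear.entry_isHomogeneous {F : MinimalGradedFreeResolution (n := n) 𝓜} {r : ℤ}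
    (hF : F.IsLinear r) (i : ℕ) (s : Fin (F.rank (i + 1))) (t : Fin (F.rank i)) :
    (F.d i (Pi.single s 1) t).IsHomogeneous 1 := by
  intro c hc
  have := F.d_form i s t c hc
  rw [hF, hF] at this
  have h1 : Finsupp.weight (1 : Fin n → ℕ) c = c.degree :=
    (DFunLike.congr_fun Finsupp.degree_eq_weight_one c).symm
  rw [h1]
  push_cast at this
  omega

lemma d_apply (F : MinimalGradedFreeResolution (n := n) 𝓜) (i : ℕ)
    (x : Fin (F.rank (i + 1)) → MvPolynomial (Fin n) k) (t : Fin (F.rank i)) :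
    F.d i x t = ∑ s, x s * F.d i (Pi.single s 1) t := by
  conv_lhs => rw [← Finset.univ_sum_single x]
  rw [map_sum, Finset.sum_apply]
  refine Finset.sum_congr rfl fun s _ => ?_
  have : (Pi.single s (x s) : Fin (F.rank (i + 1)) → MvPolynomial (Fin n) k)
      = x s • Pi.single s 1 := by
    rw [← Pi.single_smul, smul_eq_mul, mul_one]
  rw [this, map_smul, Pi.smul_apply, smul_eq_mul]

lemma ε_apply (F : MinimalGradedFreeResolution (n := n) 𝓜)
    (x : Fin (F.rank 0) → MvPolynomial (Fin n) k) :
    F.ε x = ∑ s, x s • F.ε (Pi.single s 1) := by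
  conv_lhs => rw [← Finset.univ_sum_single x]
  rw [map_sum]
  refine Finset.sum_congr rfl fun s _ => ?_
  rw [← map_smul, ← Pi.single_smul, smul_eq_mul, mul_one]

/-- The `j`-th component of the linear differential `d = ∑ⱼ Xⱼ ∂ⱼ`, as an operator on all the
spaces `Fᵢ ⊗ k` at once. -/
noncomputable def linearPart (F : MinimalGradedFreeResolution (n := n) 𝓜) (j : Fin n) :
    ((i : ℕ) → Fin (F.rank i) → k) →+ ((i : ℕ) → Fin (F.rank i) → k) where
  toFun v i t := ∑ s, v (i + 1) s * coeff (Finsupp.single j 1) (F.d i (Pi.single s 1) t)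
  map_zero' := by ext; simp
  map_add' v w := by ext; simp [add_mul, Finset.sum_add_distrib]

lemma IsLinear.d_C {F : MinimalGradedFreeResolution (n := n) 𝓜} {r : ℤ}
    (hF : F.IsLinear r) (v : (i : ℕ) → Fin (F.rank i) → k) (i : ℕ) :
    F.d i (fun s => C (v (i + 1) s)) =
      ∑ j, (X j : MvPolynomial (Fin n) k) • fun t => C (F.linearPart j v i t) := by
  ext1 t
  have key : ∀ p : MvPolynomial (Fin n) k, p.IsHomogeneous 1 →
      p = ∑ j, X j * C (coeff (Finsupp.single j 1) p) := by
    intro p hp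
    have hp' : p ∈ homogeneousSubmodule (Fin n) k 1 := hp
    rw [homogeneousSubmodule_one_eq_span_X] at hp'
    induction hp' using Submodule.span_induction with
    | mem x h =>
      obtain ⟨l, rfl⟩ := h
      rw [Finset.sum_eq_single l]
      · simp
      · intro b _ hb
        rw [coeff_X, if_neg (by simpa [Finsupp.single_left_inj] using hb.symm)]
        simp
      · simp
    | zero => simp
    | add x y hx hy h1 h2 =>
      conv_lhs => rw [h1 (by rwa [← mem_homogeneousSubmodule, homogeneousSubmodule_one_eq_span_X]),
        h2 (by rwa [← mem_homogeneousSubmodule, homogeneousSubmodule_one_eq_span_X])]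
      simp [mul_add, Finset.sum_add_distrib]
    | smul a x hx h1 =>
      conv_lhs => rw [h1 (by rwa [← mem_homogeneousSubmodule, homogeneousSubmodule_one_eq_span_X])]
      simp only [Finset.smul_sum, MvPolynomial.smul_eq_C_mul]
      refine Finset.sum_congr rfl fun j _ => ?_
      simp only [coeff_C_mul, map_mul]
      ring
  rw [d_apply, Finset.sum_apply]
  simp only [linearPart, AddMonoidHom.coe_mk, ZeroHom.coe_mk, Pi.smul_apply, smul_eq_mul, map_sum,
    map_mul, Finset.mul_sum]
  rw [Finset.sum_comm]
  refine Finset.sum_congr rfl fun s _ => ?_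
  conv_lhs => rw [key _ (hF.entry_isHomogeneous i s t), Finset.mul_sum]
  exact Finset.sum_congr rfl fun j _ => by ring

lemma coeff_X_mul_X {a b c e : Fin n} (x : k) :
    coeff (Finsupp.single a 1 + Finsupp.single b 1)
      (X c * (X e * C x) : MvPolynomial (Fin n) k) =
      if (c = a ∧ e = b) ∨ (c = b ∧ e = a) then x else 0 := by
  have : (X c * (X e * C x) : MvPolynomial (Fin n) k) =
      monomial (Finsupp.single c 1 + Finsupp.single e 1) x := by
    rw [X, X, C_apply, monomial_mul, monomial_mul]; simp
  rw [this, coeff_monomial]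
  congr 1
  rw [Finsupp.single_add_single_eq_single_add_single one_ne_zero one_ne_zero]
  simp

lemma IsLinear.linearPart_linearPart {F : MinimalGradedFreeResolution (n := n) 𝓜} {r : ℤ}
    (hF : F.IsLinear r) (v : (i : ℕ) → Fin (F.rank i) → k) (a b : Fin n) :
    (if a = b then F.linearPart a (F.linearPart a v) else
      F.linearPart a (F.linearPart b v) + F.linearPart b (F.linearPart a v)) = 0 := by
  ext i t
  have h : F.d i (F.d (i + 1) (fun s => C (v (i + 1 + 1) s))) = 0 :=
    (F.exact_succ i).apply_apply_eq_zero _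
  rw [hF.d_C v (i + 1), map_sum] at h
  simp only [map_smul, hF.d_C] at h
  -- The relations among the operators are the coefficients of `X a * X b` in `d ∘ d = 0`.
  have h2 := congrArg (coeff (Finsupp.single a 1 + Finsupp.single b 1)) (congrFun h t)
  simp only [Finset.smul_sum, Finset.sum_apply, Pi.smul_apply, smul_eq_mul, coeff_sum,
    coeff_X_mul_X, Pi.zero_apply, coeff_zero] at h2
  rcases eq_or_ne a b with rfl | hab
  · simpa [ite_and] using h2
  · rw [if_neg hab]
    -- For `a ≠ b` the two alternatives exclude each other, so the indicator is a sum.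
    have h3 : ∀ (c e : Fin n) (x : k), (if (c = a ∧ e = b) ∨ (c = b ∧ e = a) then x else 0) =
        (if c = a then (if e = b then x else 0) else 0) +
          (if c = b then (if e = a then x else 0) else 0) := by
      intro c e x
      by_cases h1 : c = a
      · subst h1
        simp [hab]
      · simp [h1, ite_and]
    simp only [h3, Finset.sum_add_distrib] at h2
    simpa [add_comm] using h2

end MinimalGradedFreeResolution
end LinearStrand
end LinearResolution

/-! ### Length of a linear resolution when `H⁰_𝔪(M) = 0` -/

namespace LinearResolution
open MvPolynomial

section Anticommuting

/-- For anticommuting operators `∂ⱼ` of square zero: `w` is killed by all `∂ⱼ` with `j ∈ S`, and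
`w = ∂ⱼ u` for some `u` killed by the other `∂ₗ`, as is the case for `w = ∏_{j ∈ S} ∂ⱼ v`. -/
def IsProductLike {n : ℕ} {V : Type*} [AddCommGroup V] (δ : Fin n → V →+ V) (S : Finset (Fin n))
    (w : V) : Prop :=
  ∀ j ∈ S, δ j w = 0 ∧ ∃ u, δ j u = w ∧ ∀ l ∈ S, l ≠ j → δ l u = 0

/-- For the new index the witness is `w` itself. For an old index `j` with witness `u`,
anticommutation makes `-δ m u` a witness, the sign coming from exchanging `δ j` and `δ m`. -/
lemma IsProductLike.insert {n : ℕ} {V : Type*} [AddCommGroup V] {δ : Fin n → V →+ V}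
    (hsq : ∀ a v, δ a (δ a v) = 0) (hanti : ∀ a b v, a ≠ b → δ a (δ b v) + δ b (δ a v) = 0)
    {S : Finset (Fin n)} {w : V} (hw : IsProductLike δ S w) (m : Fin n) (hm : m ∉ S) :
    IsProductLike δ (insert m S) (δ m w) := by
  intro j hj
  rcases Finset.mem_insert.1 hj with rfl | hj
  · refine ⟨hsq _ _, w, rfl, fun l hl hlj => ?_⟩
    exact (hw l (Finset.mem_of_mem_insert_of_ne hl hlj)).1
  · have hjm : j ≠ m := fun h => hm (h ▸ hj)
    obtain ⟨h0, u, hu, hul⟩ := hw j hj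
    have h1 := hanti j m w hjm
    rw [h0, map_zero, add_zero] at h1
    refine ⟨h1, - δ m u, ?_, fun l hl hlj => ?_⟩
    · have h2 := hanti j m u hjm
      rw [hu] at h2
      rw [map_neg, eq_neg_of_add_eq_zero_right h2]
    · rw [map_neg, neg_eq_zero]
      rcases eq_or_ne l m with rfl | hlm
      · exact hsq _ _
      · have h2 := hanti l m u hlm
        rwa [hul l (Finset.mem_of_mem_insert_of_ne hl hlm) hlj, map_zero, add_zero] at h2

/-- While the vector is nonzero in positive degree some operator does not kill it there. Its index
is new, as the operators already used kill the vector, so each step down enlarges `S` by one. -/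
lemma exists_isProductLike {n : ℕ} {W : ℕ → Type*} [∀ i, AddCommGroup (W i)]
    {δ : Fin n → (∀ i, W i) →+ (∀ i, W i)}
    (hsq : ∀ a v, δ a (δ a v) = 0) (hanti : ∀ a b v, a ≠ b → δ a (δ b v) + δ b (δ a v) = 0)
    (hker : ∀ v i, v (i + 1) ≠ 0 → ∃ j, δ j v i ≠ 0) (i : ℕ) (S : Finset (Fin n)) (w : ∀ i, W i)
    (hw : IsProductLike δ S w) (hi : w i ≠ 0) :
    ∃ (S' : Finset (Fin n)) (w' : ∀ i, W i),
      IsProductLike δ S' w' ∧ w' 0 ≠ 0 ∧ S'.card = S.card + i := by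
  induction i generalizing S w with
  | zero => exact ⟨S, w, hw, hi, rfl⟩
  | succ i ih =>
    obtain ⟨j, hj⟩ := hker w i hi
    have hjS : j ∉ S := fun h => hj (by rw [(hw j h).1]; rfl)
    obtain ⟨S', w', h1, h2, h3⟩ := ih _ _ (hw.insert hsq hanti j hjS) hj
    refine ⟨S', w', h1, h2, ?_⟩
    rw [h3, Finset.card_insert_of_notMem hjS]
    omega

end Anticommuting

section LinearStrand
variable {k : Type u} [Field k] {n : ℕ}
variable {M : Type u} [AddCommGroup M] [Module (MvPolynomial (Fin n) k) M] [Module k M]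
variable {𝓜 : ℤ → Submodule k M}

namespace MinimalGradedFreeResolution

/-- A linear resolution of a module with `H⁰_𝔪(M) = 0` has length less than `n`. -/
theorem IsLinear.rank_eq_zero {F : MinimalGradedFreeResolution (n := n) 𝓜} {r : ℤ}
    (hF : F.IsLinear r) (hH0 : zerothLocalCohomology k n M = ⊥) {i : ℕ} (hi : n ≤ i) :
    F.rank i = 0 := by
  by_contra hrank
  have hsq : ∀ a v, F.linearPart a (F.linearPart a v) = 0 := fun a v => by
    simpa using hF.linearPart_linearPart v a a
  have hanti : ∀ a b v, a ≠ b →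
      F.linearPart a (F.linearPart b v) + F.linearPart b (F.linearPart a v) = 0 :=
    fun a b v hab => by simpa [hab] using hF.linearPart_linearPart v a b
  have hker : ∀ (v : (i : ℕ) → Fin (F.rank i) → k) i, v (i + 1) ≠ 0 →
      ∃ j, F.linearPart j v i ≠ 0 := by
    intro v i hv
    by_contra! h
    refine hv (funext fun s => ?_)
    have h1 : F.d i (fun s => C (v (i + 1) s)) = 0 := by
      rw [hF.d_C]
      refine Finset.sum_eq_zero fun j _ => ?_
      rw [h j]
      ext; simp
    simpa using F.constantCoeff_of_d_eq_zero h1 s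
  let v : (i : ℕ) → Fin (F.rank i) → k := fun _ _ => 1
  have hv : v i ≠ 0 := fun h => by
    simpa [v] using congrFun h ⟨0, Nat.pos_of_ne_zero hrank⟩
  obtain ⟨S, w, hw, hw0, hS⟩ := exists_isProductLike hsq hanti hker i ∅ v
    (fun j hj => by simp at hj) hv
  -- `S` has `i ≥ n` elements inside `Fin n`.
  have hSuniv : S = Finset.univ := by
    refine Finset.eq_univ_of_card _ ((S.card_le_univ).antisymm ?_)
    simpa [hS] using hi
  subst hSuniv
  -- The witness `u` is killed by every operator except the `j`-th, so `d u = X j • w`, and `ε`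
  -- kills boundaries.
  have hX : ∀ j, (X j : MvPolynomial (Fin n) k) • F.ε (fun s => C (w 0 s)) = 0 := by
    intro j
    obtain ⟨-, u, hu, hul⟩ := hw j (Finset.mem_univ _)
    have h1 := hF.d_C u 0
    rw [Finset.sum_eq_single j, hu] at h1
    · rw [← map_smul, ← h1]
      exact F.exact_zero.apply_apply_eq_zero _
    · intro l _ hl
      rw [hul l (Finset.mem_univ _) hl]
      ext; simp
    · simp
  have hmem : F.ε (fun s => C (w 0 s)) ∈ zerothLocalCohomology k n M := by
    refine Submodule.mem_iSup_of_mem 1 ?_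
    rw [pow_one, maxIdeal, ← Submodule.torsionBySet_eq_torsionBySet_span,
      Submodule.mem_torsionBySet_iff]
    rintro ⟨_, j, rfl⟩
    exact hX j
  rw [hH0, Submodule.mem_bot] at hmem
  refine hw0 (funext fun s => ?_)
  simpa using F.constantCoeff_of_ε_eq_zero hmem s

end MinimalGradedFreeResolution
end LinearStrand
end LinearResolution

/-! ### Hilbert function of a linear resolution -/

namespace LinearResolution
open MvPolynomial

section HilbertFunction

lemma finrank_homogeneousSubmodule (k : Type*) [Field k] (n j : ℕ) :
    Module.finrank k (homogeneousSubmodule (Fin n) k j) = (n + j - 1).choose j := by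
  have h : homogeneousSubmodule (Fin n) k j = restrictSupport k {d | d.degree = j} :=
    homogeneousSubmodule_eq_finsupp_supported _ _ _
  rw [h, Module.finrank_eq_nat_card_basis (basisRestrictSupport k {d : Fin n →₀ ℕ | d.degree = j})]
  have h2 : {d : Fin n →₀ ℕ | d.degree = j} =
      ((Finset.finsuppAntidiag Finset.univ j : Finset (Fin n →₀ ℕ)) : Set (Fin n →₀ ℕ)) := by
    ext d
    simp [Finsupp.degree_eq_sum]
  rw [h2, Nat.card_coe_set_eq, Set.ncard_coe_finset, Finset.card_finsuppAntidiag_nat_eq_choose]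
  simp

lemma finrank_map_add_finrank_of_inf_ker {k V W : Type*} [Field k] [AddCommGroup V] [Module k V]
    [AddCommGroup W] [Module k W] (f : V →ₗ[k] W) (G K : Submodule k V) [Module.Finite k G]
    (hK : G ⊓ LinearMap.ker f = K) :
    Module.finrank k (G.map f) + Module.finrank k K = Module.finrank k G := by
  rw [← LinearMap.finrank_range_add_finrank_ker (f.domRestrict G), LinearMap.range_domRestrict]
  congr 1
  subst hK
  refine LinearEquiv.finrank_eq ((Submodule.comapSubtypeEquivOfLe inf_le_left).symm ≪≫ₗ
    LinearEquiv.ofEq _ _ ?_)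
  ext x
  simp

/-- Vectors whose entries are forms of degree `j`. -/
noncomputable def formVectors (k : Type*) [Field k] (n m j : ℕ) :
    Submodule k (Fin m → MvPolynomial (Fin n) k) :=
  Submodule.pi Set.univ fun _ => homogeneousSubmodule (Fin n) k j

lemma mem_formVectors {k : Type*} [Field k] {n m j : ℕ} {x : Fin m → MvPolynomial (Fin n) k} :
    x ∈ formVectors k n m j ↔ ∀ s, (x s).IsHomogeneous j := by
  simp [formVectors, Submodule.mem_pi]

noncomputable def formVectorsEquiv (k : Type*) [Field k] (n m j : ℕ) :
    formVectors k n m j ≃ₗ[k] (Fin m → homogeneousSubmodule (Fin n) k j) where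
  toFun x s := ⟨x.1 s, mem_formVectors.1 x.2 s⟩
  invFun x := ⟨fun s => (x s).1, mem_formVectors.2 fun s => (x s).2⟩
  map_add' _ _ := rfl
  map_smul' _ _ := rfl

instance (k : Type*) [Field k] (n j : ℕ) : Module.Finite k (homogeneousSubmodule (Fin n) k j) :=
  Module.Finite.iff_fg.2 (homogeneousSubmodule_fg _ _ j)

instance (k : Type*) [Field k] (n m j : ℕ) : Module.Finite k (formVectors k n m j) :=
  Module.Finite.equiv (formVectorsEquiv k n m j).symm

lemma finrank_formVectors (k : Type*) [Field k] (n m j : ℕ) :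
    Module.finrank k (formVectors k n m j) = m * (n + j - 1).choose j := by
  rw [(formVectorsEquiv k n m j).finrank_eq, Module.finrank_pi_fintype]
  simp [finrank_homogeneousSubmodule]

lemma homogeneousComponent_mul {k : Type*} [Field k] {n : ℕ} {p q : MvPolynomial (Fin n) k}
    {i j : ℕ} (hq : q.IsHomogeneous j) :
    homogeneousComponent (i + j) (p * q) = homogeneousComponent i p * q := by
  let _ := MvPolynomial.gradedAlgebra (σ := Fin n) (R := k)
  have h := DirectSum.coe_decompose_mul_add_of_right_mem (homogeneousSubmodule (Fin n) k)
    (a := p) (i := i) (j := j) (b := q) hq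
  have h2 : ∀ (p : MvPolynomial (Fin n) k) (i : ℕ),
      (DirectSum.decompose (homogeneousSubmodule (Fin n) k) p i : MvPolynomial (Fin n) k) =
        homogeneousComponent i p := decomposition.decompose'_apply
  rwa [h2, h2] at h

variable {k : Type u} [Field k] {n : ℕ}
variable {M : Type u} [AddCommGroup M] [Module (MvPolynomial (Fin n) k) M] [Module k M]
variable {𝓜 : ℤ → Submodule k M}

namespace MinimalGradedFreeResolution

variable {F : MinimalGradedFreeResolution (n := n) 𝓜} {r : ℤ}

lemma IsLinear.d_mem_formVectors (hF : F.IsLinear r) {i j : ℕ}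
    {x : Fin (F.rank (i + 1)) → MvPolynomial (Fin n) k} (hx : x ∈ formVectors k n _ j) :
    F.d i x ∈ formVectors k n _ (j + 1) := by
  refine mem_formVectors.2 fun t => ?_
  rw [d_apply]
  exact IsHomogeneous.sum _ _ _ fun s _ =>
    (mem_formVectors.1 hx s).mul (hF.entry_isHomogeneous i s t)

lemma IsLinear.homogeneousComponent_d (hF : F.IsLinear r) (i j : ℕ)
    (x : Fin (F.rank (i + 1)) → MvPolynomial (Fin n) k) (t : Fin (F.rank i)) :
    homogeneousComponent (j + 1) (F.d i x t) =
      F.d i (fun s => homogeneousComponent j (x s)) t := by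
  rw [d_apply, d_apply, map_sum]
  exact Finset.sum_congr rfl fun s _ => homogeneousComponent_mul (hF.entry_isHomogeneous i s t)

/-- The entries of `d` are linear forms, so a preimage may be replaced by its component of degree
`j`. -/
lemma IsLinear.mem_map_d_of_form (hF : F.IsLinear r) {i j : ℕ}
    {x : Fin (F.rank i) → MvPolynomial (Fin n) k} (hx : x ∈ formVectors k n _ (j + 1))
    (hd : x ∈ Set.range (F.d i)) :
    x ∈ (formVectors k n _ j).map ((F.d i).restrictScalars k) := by
  obtain ⟨y, rfl⟩ := hd
  refine ⟨fun s => homogeneousComponent j (y s),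
    mem_formVectors.2 fun s => homogeneousComponent_isHomogeneous _ _, ?_⟩
  ext1 t
  rw [LinearMap.restrictScalars_apply, ← hF.homogeneousComponent_d]
  have := mem_formVectors.1 hx t
  rw [homogeneousComponent_of_mem this, if_pos rfl]

lemma eq_zero_of_form_zero {m : ℕ} {x : Fin m → MvPolynomial (Fin n) k}
    (hx : x ∈ formVectors k n m 0) (hc : ∀ s, constantCoeff (x s) = 0) : x = 0 := by
  ext1 s
  have h := mem_formVectors.1 hx s
  have h2 : x s = C (coeff 0 (x s)) := totalDegree_eq_zero_iff_eq_C.1 (by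
    exact Nat.le_zero.1 h.totalDegree_le)
  rw [h2, ← constantCoeff_eq, hc s, C_0, Pi.zero_apply]

/-- Rank-nullity for the strand of the linear resolution ending in `F_{i+1}`. -/
lemma IsLinear.finrank_map_d_succ (hF : F.IsLinear r) (i j : ℕ) :
    Module.finrank k ((formVectors k n _ (j + 1)).map ((F.d i).restrictScalars k)) +
      Module.finrank k ((formVectors k n _ j).map ((F.d (i + 1)).restrictScalars k)) =
    F.rank (i + 1) * (n + (j + 1) - 1).choose (j + 1) := by
  rw [← finrank_formVectors k]
  refine finrank_map_add_finrank_of_inf_ker _ _ _ (le_antisymm ?_ ?_)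
  · rintro x ⟨hx, hd⟩
    exact hF.mem_map_d_of_form hx ((F.exact_succ i x).1 hd)
  · rintro _ ⟨y, hy, rfl⟩
    exact ⟨hF.d_mem_formVectors hy, (F.exact_succ i).apply_apply_eq_zero y⟩

lemma finrank_map_d_zero (F : MinimalGradedFreeResolution (n := n) 𝓜) (i : ℕ) :
    Module.finrank k ((formVectors k n _ 0).map ((F.d i).restrictScalars k)) = F.rank (i + 1) := by
  have := finrank_map_add_finrank_of_inf_ker ((F.d i).restrictScalars k)
    (formVectors k n _ 0) ⊥ (by
      refine (Submodule.eq_bot_iff _).2 ?_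
      rintro x ⟨hx, hd⟩
      exact eq_zero_of_form_zero hx (F.constantCoeff_of_d_eq_zero hd))
  rw [finrank_formVectors] at this
  simpa using this

lemma IsLinear.ε_mem (h𝓜 : IsGradedModule (n := n) 𝓜) (hF : F.IsLinear r) {j : ℕ}
    {x : Fin (F.rank 0) → MvPolynomial (Fin n) k} (hx : x ∈ formVectors k n _ j) :
    F.ε x ∈ 𝓜 (r + j) := by
  rw [ε_apply]
  refine Submodule.sum_mem _ fun s _ => ?_
  have h := F.ε_mem s
  rw [hF] at h
  simpa using h𝓜.smul_mem j _ _ _ (mem_formVectors.1 hx s) h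

/-- Unrolls `finrank_map_d_succ`: each step lowers the form degree and raises the homological
degree, so the recursion ends at constants and needs no bound on the length of `F`. -/
lemma IsLinear.finrank_map_d (hF : F.IsLinear r) (i j : ℕ) :
    (Module.finrank k ((formVectors k n _ j).map ((F.d i).restrictScalars k)) : ℚ) =
      ∑ l ∈ Finset.range (j + 1), (-1 : ℚ) ^ l * F.rank (i + 1 + l) *
        (n + (j - l) - 1).choose (j - l) := by
  induction j generalizing i with
  | zero => simp [finrank_map_d_zero]
  | succ j ih =>
    have h := hF.finrank_map_d_succ i j
    rw [← @Nat.cast_inj ℚ] at h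
    push_cast at h
    rw [ih] at h
    rw [eq_sub_of_add_eq h, Finset.sum_range_succ' _ (j + 1), sub_eq_neg_add,
      ← Finset.sum_neg_distrib]
    congr 1
    · refine Finset.sum_congr rfl fun l _ => ?_
      rw [show i + 1 + (l + 1) = i + 1 + 1 + l by ring, Nat.add_sub_add_right]
      ring
    · simp

variable [IsScalarTower k (MvPolynomial (Fin n) k) M]

lemma IsLinear.map_ε (h𝓜 : IsGradedModule (n := n) 𝓜) (hF : F.IsLinear r) (j : ℕ) :
    (formVectors k n _ j).map (F.ε.restrictScalars k) = 𝓜 (r + j) := by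
  refine le_antisymm ?_ fun m hm => ?_
  · rintro _ ⟨y, hy, rfl⟩
    exact hF.ε_mem h𝓜 hy
  · obtain ⟨y, rfl⟩ := F.ε_surjective m
    let _ := h𝓜.isInternal.chooseDecomposition
    refine ⟨fun s => homogeneousComponent j (y s),
      mem_formVectors.2 fun s => homogeneousComponent_isHomogeneous _ _, ?_⟩
    -- Exceeds every total degree, so that all components are summed, and also `j`, so that the
    -- `j`-th one is among them.
    let N := (Finset.univ.sup fun s => (y s).totalDegree) + j + 1
    have hy : y = ∑ l ∈ Finset.range N, fun s => homogeneousComponent l (y s) := by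
      ext1 s
      rw [Finset.sum_apply]
      conv_lhs => rw [← sum_homogeneousComponent (y s)]
      refine Finset.sum_subset ?_ ?_
      · refine Finset.range_subset_range.2 ?_
        have := Finset.le_sup (f := fun s => (y s).totalDegree) (Finset.mem_univ s)
        simp only [N]
        omega
      · intro l _ hl
        exact homogeneousComponent_eq_zero _ _ (by simpa using hl)
    have hmem : ∀ l : ℕ, F.ε (fun s => homogeneousComponent l (y s)) ∈ 𝓜 (r + l) := fun l =>
      hF.ε_mem h𝓜 (mem_formVectors.2 fun s => homogeneousComponent_isHomogeneous _ _)
    rw [LinearMap.restrictScalars_apply, ← DirectSum.decompose_of_mem_same 𝓜 hm]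
    conv_rhs => rw [hy]
    rw [map_sum, DirectSum.decompose_sum, DFinsupp.finsetSum_apply, Submodule.coe_sum,
      Finset.sum_eq_single j]
    · rw [DirectSum.decompose_of_mem_same 𝓜 (hmem j)]
    · intro l _ hl
      exact DirectSum.decompose_of_mem_ne 𝓜 (hmem l) (by simpa using hl)
    · intro h
      exact absurd (Finset.mem_range.2 (by simp only [N]; omega)) h

lemma IsLinear.finite_component (h𝓜 : IsGradedModule (n := n) 𝓜) (hF : F.IsLinear r) (j : ℕ) :
    Module.Finite k (𝓜 (r + j)) := by
  rw [← hF.map_ε h𝓜]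
  infer_instance

lemma IsLinear.hilbertFunction_succ (h𝓜 : IsGradedModule (n := n) 𝓜) (hF : F.IsLinear r)
    (j : ℕ) : hilbertFunction 𝓜 (r + (j + 1 : ℕ)) +
      Module.finrank k ((formVectors k n _ j).map ((F.d 0).restrictScalars k)) =
    F.rank 0 * (n + (j + 1) - 1).choose (j + 1) := by
  rw [hilbertFunction, ← hF.map_ε h𝓜, ← finrank_formVectors k]
  refine finrank_map_add_finrank_of_inf_ker _ _ _ (le_antisymm ?_ ?_)
  · rintro x ⟨hx, hd⟩
    exact hF.mem_map_d_of_form hx ((F.exact_zero x).1 hd)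
  · rintro _ ⟨y, hy, rfl⟩
    exact ⟨hF.d_mem_formVectors hy, F.exact_zero.apply_apply_eq_zero y⟩

lemma IsLinear.hilbertFunction_zero (h𝓜 : IsGradedModule (n := n) 𝓜) (hF : F.IsLinear r) :
    hilbertFunction 𝓜 r = F.rank 0 := by
  have := finrank_map_add_finrank_of_inf_ker (F.ε.restrictScalars k)
    (formVectors k n _ 0) ⊥ (by
      refine (Submodule.eq_bot_iff _).2 ?_
      rintro x ⟨hx, hd⟩
      exact eq_zero_of_form_zero hx (F.constantCoeff_of_ε_eq_zero hd))
  rw [finrank_formVectors, hF.map_ε h𝓜, Nat.cast_zero, add_zero] at this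
  simpa [hilbertFunction] using this

/-- The Hilbert function of a module with a linear resolution. -/
theorem IsLinear.hilbertFunction_eq (h𝓜 : IsGradedModule (n := n) 𝓜) (hF : F.IsLinear r)
    (j : ℕ) : (hilbertFunction 𝓜 (r + j) : ℚ) =
      ∑ l ∈ Finset.range (j + 1), (-1 : ℚ) ^ l * F.rank l * (n + (j - l) - 1).choose (j - l) := by
  cases j with
  | zero => simp [hF.hilbertFunction_zero h𝓜]
  | succ j =>
    have h := hF.hilbertFunction_succ h𝓜 j
    rw [← @Nat.cast_inj ℚ, Nat.cast_add, hF.finrank_map_d] at h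
    rw [eq_sub_of_add_eq h, Finset.sum_range_succ' _ (j + 1), sub_eq_neg_add,
      ← Finset.sum_neg_distrib]
    congr 1
    · refine Finset.sum_congr rfl fun l _ => ?_
      rw [show 0 + 1 + l = l + 1 by ring, Nat.add_sub_add_right]
      ring
    · simp

end MinimalGradedFreeResolution
end HilbertFunction
end LinearResolution

/-! ### Krull dimension and growth -/

namespace LinearResolution
open MvPolynomial

section Dimension

/-- Lying over starts the chain of primes and going up extends it. -/
lemma exists_ltSeries_of_isIntegral {A B : Type*} [CommRing A] [CommRing B] [Algebra B A]
    [Algebra.IsIntegral B A] (hinj : Function.Injective (algebraMap B A))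
    (p : LTSeries (PrimeSpectrum B)) :
    ∃ q : LTSeries (PrimeSpectrum A), q.length = p.length ∧
      PrimeSpectrum.comap (algebraMap B A) q.last = p.last := by
  induction p using RelSeries.inductionOn' with
  | singleton x =>
    obtain ⟨Q, -, hQ, hQ'⟩ := Ideal.exists_ideal_over_prime_of_isIntegral x.asIdeal (⊥ : Ideal A)
      (by
        rw [← RingHom.ker_eq_comap_bot, (RingHom.injective_iff_ker_eq_bot _).1 hinj]
        exact bot_le)
    exact ⟨RelSeries.singleton _ ⟨Q, hQ⟩, rfl, PrimeSpectrum.ext hQ'⟩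
  | snoc p x hx ih =>
    obtain ⟨q, hq, hlast⟩ := ih
    have hlt : p.last < x := hx
    obtain ⟨Q, hle, hQ, hQ'⟩ := Ideal.exists_ideal_over_prime_of_isIntegral x.asIdeal
      q.last.asIdeal (by
        have : PrimeSpectrum.comap (algebraMap B A) q.last ≤ x := hlast ▸ hlt.le
        exact this)
    refine ⟨q.snoc ⟨Q, hQ⟩ (lt_of_le_of_ne hle ?_), by simp [hq], ?_⟩
    · intro h
      exact hlt.ne (hlast.symm.trans
        (PrimeSpectrum.ext ((congrArg (Ideal.comap (algebraMap B A)) h).trans hQ')))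
    · rw [RelSeries.last_snoc, RelSeries.last_snoc]
      exact PrimeSpectrum.ext hQ'

lemma ringKrullDim_le_of_isIntegral {A B : Type*} [CommRing A] [CommRing B] [Algebra B A]
    [Algebra.IsIntegral B A] (hinj : Function.Injective (algebraMap B A)) :
    ringKrullDim B ≤ ringKrullDim A := by
  refine iSup_le fun p => ?_
  obtain ⟨q, hq, -⟩ := exists_ltSeries_of_isIntegral hinj p
  rw [← hq]
  exact le_iSup (fun q : LTSeries (PrimeSpectrum A) => (q.length : WithBot ℕ∞)) q

lemma finrank_restrictTotalDegree_le (k : Type*) [Field k] (s a : ℕ) :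
    Module.finrank k (restrictTotalDegree (Fin s) k a) ≤ (a + 1) ^ s := by
  refine (Submodule.finrank_mono
    (restrictTotalDegree_le_restrictDegree (σ := Fin s) (R := k) a)).trans ?_
  rw [restrictDegree, Module.finrank_eq_nat_card_basis (basisRestrictSupport k _)]
  let f : {c : Fin s →₀ ℕ | ∀ i, c i ≤ a} → (Fin s → Fin (a + 1)) :=
    fun c i => ⟨c.1 i, Nat.lt_succ_of_le (c.2 i)⟩
  have hf : Function.Injective f := fun c c' h => by
    ext i
    simpa [f] using congrFun h i
  simpa using Nat.card_le_card_of_injective f hf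

lemma exists_noether_generators_of_algebra (k : Type*) [Field k] (A M : Type*) [CommRing A]
    [Nontrivial A] [Algebra k A] [Algebra.FiniteType k A] [AddCommGroup M] [Module A M]
    [Module.Finite A M] :
    ∃ (s : ℕ) (g : MvPolynomial (Fin s) k →ₐ[k] A) (q : ℕ) (m : Fin q → M),
      (s : WithBot ℕ∞) ≤ ringKrullDim A ∧
      ∀ x : M, ∃ b : Fin q → MvPolynomial (Fin s) k, x = ∑ l, g (b l) • m l := by
  obtain ⟨s, g, hg, hfin⟩ := exists_finite_inj_algHom_of_fg k A
  let _ : Algebra (MvPolynomial (Fin s) k) A := g.toRingHom.toAlgebra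
  have : Module.Finite (MvPolynomial (Fin s) k) A := hfin
  let _ : Module (MvPolynomial (Fin s) k) M := Module.compHom M g.toRingHom
  have : IsScalarTower (MvPolynomial (Fin s) k) A M := ⟨fun b a x => mul_smul (g b) a x⟩
  have : Module.Finite (MvPolynomial (Fin s) k) M := Module.Finite.trans A M
  obtain ⟨q, m, hm⟩ := Module.Finite.exists_fin (R := MvPolynomial (Fin s) k) (M := M)
  refine ⟨s, g, q, m, ?_, fun x => ?_⟩
  · refine le_trans (le_of_eq ?_) (ringKrullDim_le_of_isIntegral
      (B := MvPolynomial (Fin s) k) (A := A) hg)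
    rw [MvPolynomial.ringKrullDim_of_isNoetherianRing, ringKrullDim_eq_zero_of_field]
    simp
  · obtain ⟨b, hb⟩ := (Submodule.mem_span_range_iff_exists_fun _).1
      (hm ▸ Submodule.mem_top : x ∈ Submodule.span _ (Set.range m))
    exact ⟨b, hb.symm⟩

variable {k : Type u} [Field k] {n : ℕ}
variable {M : Type u} [AddCommGroup M] [Module (MvPolynomial (Fin n) k) M] [Module k M]

omit [Module k M] in
-- Noether normalization of `R ⧸ ann M`, whose dimension is that of the support, with the images of
-- the variables lifted to `R`; the lift acts on `M` in the same way.
lemma exists_noether_generators [Module.Finite (MvPolynomial (Fin n) k) M] [Nontrivial M] :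
    ∃ (s : ℕ) (φ : MvPolynomial (Fin s) k →ₐ[k] MvPolynomial (Fin n) k) (q : ℕ) (m : Fin q → M),
      (s : WithBot ℕ∞) ≤ Module.supportDim (MvPolynomial (Fin n) k) M ∧
      ∀ x : M, ∃ b : Fin q → MvPolynomial (Fin s) k, x = ∑ l, φ (b l) • m l := by
  let I := Module.annihilator (MvPolynomial (Fin n) k) M
  have hI : I ≠ ⊤ := fun h => by
    obtain ⟨x, hx⟩ := exists_ne (0 : M)
    have h1 : (1 : MvPolynomial (Fin n) k) ∈ I := by rw [h]; exact Submodule.mem_top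
    exact hx (by simpa using Module.mem_annihilator.1 h1 x)
  have : Nontrivial (MvPolynomial (Fin n) k ⧸ I) := Ideal.Quotient.nontrivial_iff.2 hI
  let _ : Module (MvPolynomial (Fin n) k ⧸ I) M := Module.quotientAnnihilator
  have : IsScalarTower (MvPolynomial (Fin n) k) (MvPolynomial (Fin n) k ⧸ I) M := inferInstance
  have : Module.Finite (MvPolynomial (Fin n) k ⧸ I) M :=
    Module.Finite.of_restrictScalars_finite (MvPolynomial (Fin n) k) _ _
  obtain ⟨s, g, q, m, hs, hm⟩ :=
    exists_noether_generators_of_algebra k (MvPolynomial (Fin n) k ⧸ I) M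
  choose f hf using fun i => Ideal.Quotient.mk_surjective (g (X i))
  let φ : MvPolynomial (Fin s) k →ₐ[k] MvPolynomial (Fin n) k := aeval f
  have hφ : ∀ b, Ideal.Quotient.mk I (φ b) = g b := by
    intro b
    have : (Ideal.Quotient.mkₐ k I).comp φ = g := by
      ext i
      simp [φ, hf]
    exact DFunLike.congr_fun this b
  refine ⟨s, φ, q, m, ?_, fun x => ?_⟩
  · rwa [Module.supportDim_eq_ringKrullDim_quotient_annihilator]
  · obtain ⟨b, hb⟩ := hm x
    refine ⟨b, hb.trans (Finset.sum_congr rfl fun l _ => ?_)⟩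
    rw [← hφ]
    rfl

variable [IsScalarTower k (MvPolynomial (Fin n) k) M]

/-- A finitely generated module of dimension `d` carries an exhaustive filtration compatible with
multiplication by variables, whose dimensions grow at most like a polynomial of degree `d`. -/
lemma exists_filtration [Module.Finite (MvPolynomial (Fin n) k) M] [Nontrivial M] :
    ∃ (s q D : ℕ) (W : ℕ → Submodule k M),
      (s : WithBot ℕ∞) ≤ Module.supportDim (MvPolynomial (Fin n) k) M ∧
      Monotone W ∧ (∀ x, ∃ a, x ∈ W a) ∧
      (∀ a, Module.Finite k (W a)) ∧ (∀ a, Module.finrank k (W a) ≤ q * (a + 1) ^ s) ∧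
      ∀ (i : Fin n) (a : ℕ), ∀ x ∈ W a, (X i : MvPolynomial (Fin n) k) • x ∈ W (a + D) := by
  obtain ⟨s, φ, q, m, hs, hm⟩ := exists_noether_generators (k := k) (n := n) (M := M)
  let Θ : (Fin q → MvPolynomial (Fin s) k) →ₗ[k] M :=
    { toFun := fun b => ∑ l, φ (b l) • m l
      map_add' := fun b c => by simp [add_smul, Finset.sum_add_distrib]
      map_smul' := fun c b => by simp [Finset.smul_sum] }
  -- The filtration consists of the combinations of the generators `m l` with coefficients of total
  -- degree at most `a`.
  let W' : ℕ → Submodule k (Fin q → MvPolynomial (Fin s) k) :=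
    fun a => Submodule.pi Set.univ fun _ => restrictTotalDegree (Fin s) k a
  have hW' : ∀ a b, b ∈ W' a ↔ ∀ l, (b l).totalDegree ≤ a := fun a b => by
    simp [W', Submodule.mem_pi, mem_restrictTotalDegree]
  let e : ∀ a, W' a ≃ₗ[k] (Fin q → restrictTotalDegree (Fin s) k a) := fun a =>
    { toFun := fun x l => ⟨x.1 l, (mem_restrictTotalDegree _ _ _).2 ((hW' a _).1 x.2 l)⟩
      invFun := fun x => ⟨fun l => (x l).1,
        (hW' a _).2 fun l => (mem_restrictTotalDegree _ _ _).1 (x l).2⟩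
      map_add' := fun _ _ => rfl
      map_smul' := fun _ _ => rfl }
  have hfin : ∀ a, Module.Finite k (W' a) := fun a => Module.Finite.equiv (e a).symm
  choose B hB using fun (i : Fin n) (l : Fin q) => hm ((X i : MvPolynomial (Fin n) k) • m l)
  -- Bounds the coefficients that express each `X i • m l` in the generators.
  let D := Finset.univ.sup fun i => Finset.univ.sup fun l => Finset.univ.sup fun l' =>
    (B i l l').totalDegree
  have hD : ∀ i l l', (B i l l').totalDegree ≤ D := fun i l l' =>
    (Finset.le_sup (f := fun l' => (B i l l').totalDegree) (Finset.mem_univ l')).trans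
      ((Finset.le_sup (f := fun l => Finset.univ.sup fun l' => (B i l l').totalDegree)
        (Finset.mem_univ l)).trans
      (Finset.le_sup (f := fun i => Finset.univ.sup fun l => Finset.univ.sup fun l' =>
        (B i l l').totalDegree) (Finset.mem_univ i)))
  refine ⟨s, q, D, fun a => (W' a).map Θ, hs, ?_, ?_, ?_, ?_, ?_⟩
  · exact fun a b hab => Submodule.map_mono fun x hx =>
      (hW' b x).2 fun l => ((hW' a x).1 hx l).trans hab
  · intro x
    obtain ⟨b, rfl⟩ := hm x
    exact ⟨Finset.univ.sup fun l => (b l).totalDegree, b, (hW' _ _).2 fun l =>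
      Finset.le_sup (f := fun l => (b l).totalDegree) (Finset.mem_univ l), rfl⟩
  · exact fun a => inferInstance
  · intro a
    refine (Submodule.finrank_map_le Θ (W' a)).trans ?_
    rw [(e a).finrank_eq, Module.finrank_pi_fintype]
    simpa using Nat.mul_le_mul_left q (finrank_restrictTotalDegree_le k s a)
  · rintro i a _ ⟨b, hb, rfl⟩
    refine ⟨fun l' => ∑ l, b l * B i l l', (hW' _ _).2 fun l' => ?_, ?_⟩
    · refine totalDegree_finsetSum_le fun l _ => ?_
      exact (totalDegree_mul _ _).trans (Nat.add_le_add ((hW' _ _).1 hb l) (hD i l l'))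
    · change ∑ l', φ (∑ l, b l * B i l l') • m l' = X i • ∑ l, φ (b l) • m l
      simp only [map_sum, Finset.sum_smul, Finset.smul_sum, map_mul]
      rw [Finset.sum_comm]
      refine Finset.sum_congr rfl fun l _ => ?_
      rw [smul_comm, hB i l, Finset.smul_sum]
      exact Finset.sum_congr rfl fun l' _ => mul_smul _ _ _

omit [IsScalarTower k (MvPolynomial (Fin n) k) M] in
lemma monomial_smul_mem_of_filtration {W : ℕ → Submodule k M} {D : ℕ}
    (hX : ∀ (i : Fin n) (a : ℕ), ∀ x ∈ W a, (X i : MvPolynomial (Fin n) k) • x ∈ W (a + D))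
    (c : Fin n →₀ ℕ) : ∀ (a : ℕ), ∀ x ∈ W a,
      (monomial c 1 : MvPolynomial (Fin n) k) • x ∈ W (a + D * c.degree) := by
  induction c using Finsupp.induction_linear with
  | zero => intro a x hx; simpa using hx
  | add f g hf hg =>
    intro a x hx
    have := hf _ _ (hg a x hx)
    rw [smul_smul, monomial_mul, one_mul] at this
    rw [map_add]
    convert this using 2
    ring
  | single i b =>
    induction b with
    | zero => intro a x hx; simpa using hx
    | succ b ih =>
      intro a x hx
      have := hX i _ _ (ih a x hx)
      rw [smul_smul, X, monomial_mul, one_mul, ← Finsupp.single_add, add_comm 1 b] at this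
      convert this using 2
      simp
      ring

lemma smul_mem_of_filtration {W : ℕ → Submodule k M} {D : ℕ} (hmono : Monotone W)
    (hX : ∀ (i : Fin n) (a : ℕ), ∀ x ∈ W a, (X i : MvPolynomial (Fin n) k) • x ∈ W (a + D))
    {p : MvPolynomial (Fin n) k} {j a : ℕ} (hp : p.totalDegree ≤ j) {x : M} (hx : x ∈ W a) :
    p • x ∈ W (a + D * j) := by
  rw [p.as_sum, Finset.sum_smul]
  refine Submodule.sum_mem _ fun c hc => ?_
  have h : monomial c (coeff c p) = coeff c p • monomial c 1 := by
    rw [smul_monomial, smul_eq_mul, mul_one]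
  rw [h, smul_assoc]
  refine Submodule.smul_mem _ _ (hmono ?_ (monomial_smul_mem_of_filtration hX c a x hx))
  have : c.degree ≤ j := (le_totalDegree hc).trans hp
  gcongr

variable {𝓜 : ℤ → Submodule k M}

/-- The sum of the Hilbert function of a module of dimension `d` grows at most like a polynomial of
degree `d`. -/
theorem MinimalGradedFreeResolution.IsLinear.exists_sum_hilbertFunction_le
    [Module.Finite (MvPolynomial (Fin n) k) M] [Nontrivial M]
    {F : MinimalGradedFreeResolution (n := n) 𝓜} {r : ℤ}
    (h𝓜 : IsGradedModule (n := n) 𝓜) (hF : F.IsLinear r) :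
    ∃ (s q c D : ℕ), (s : WithBot ℕ∞) ≤ Module.supportDim (MvPolynomial (Fin n) k) M ∧
      ∀ j : ℕ, ∑ i ∈ Finset.range (j + 1), hilbertFunction 𝓜 (r + i) ≤
        q * (c + D * j + 1) ^ s := by
  obtain ⟨s, q, D, W, hs, hmono, hex, hfin, hrank, hX⟩ :=
    exists_filtration (k := k) (n := n) (M := M)
  choose a ha using fun t => hex (F.ε (Pi.single t 1))
  let c := Finset.univ.sup a
  refine ⟨s, q, c, D, hs, fun j => (?_ : _ ≤ _).trans (hrank (c + D * j))⟩
  -- The images of the basis vectors lie in `W c`, and multiplying by a form of degree at most `j`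
  -- costs at most `D * j` filtration steps. These components are independent, so their dimensions
  -- add up inside `W (c + D * j)`.
  have hle : ∀ i ≤ j, 𝓜 (r + i) ≤ W (c + D * j) := by
    intro i hij
    rw [← hF.map_ε h𝓜]
    rintro _ ⟨y, hy, rfl⟩
    rw [LinearMap.restrictScalars_apply, ε_apply]
    refine Submodule.sum_mem _ fun t _ => smul_mem_of_filtration hmono hX
      (((mem_formVectors.1 hy t).totalDegree_le).trans hij)
      (hmono (Finset.le_sup (Finset.mem_univ t)) (ha t))
  have hfin' : ∀ i : Fin (j + 1), Module.Finite k (𝓜 (r + (i : ℕ))) :=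
    fun i => hF.finite_component h𝓜 i
  let f : ((i : Fin (j + 1)) → 𝓜 (r + (i : ℕ))) →ₗ[k] W (c + D * j) :=
    LinearMap.lsum k _ k fun i => Submodule.inclusion (hle i (by omega))
  have hf : Function.Injective f := by
    let _ := h𝓜.isInternal.chooseDecomposition
    refine (injective_iff_map_eq_zero f).2 fun x hx => funext fun i => ?_
    have h1 : (∑ l, (x l : M)) = 0 := by
      simpa [f] using congrArg Subtype.val hx
    have h2 : ∑ l, (DirectSum.decompose 𝓜 (x l : M) (r + (i : ℕ)) : M) = 0 := by
      rw [← Submodule.coe_sum, ← DFinsupp.finsetSum_apply, ← DirectSum.decompose_sum, h1,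
        DirectSum.decompose_zero]
      rfl
    rw [Finset.sum_eq_single i] at h2
    · rw [DirectSum.decompose_of_mem_same 𝓜 (x i).2] at h2
      ext
      simpa using h2
    · intro l _ hl
      exact DirectSum.decompose_of_mem_ne 𝓜 (x l).2 (by simpa [Fin.val_inj] using hl)
    · simp
  have := LinearMap.finrank_le_finrank_of_injective hf
  rw [Module.finrank_pi_fintype] at this
  rwa [Finset.sum_range]

end Dimension
end LinearResolution

/-! ### Generating functions and inversion -/

namespace LinearResolution

section Numerics
open Polynomial

/-- As a polynomial in `j`, `C(j - i + e, e)` has roots at `j - i = -1, …, -e`. -/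
lemma eval_preHilbertPoly_eq_zero {e i j : ℕ} (hji : j < i) (hie : i ≤ e) :
    (preHilbertPoly ℚ e i).eval (j : ℚ) = 0 := by
  have h : ((j : ℚ) - i + 1) = -((i - j - 1 : ℕ) : ℚ) := by
    obtain ⟨t, rfl⟩ := Nat.exists_eq_add_of_lt hji
    rw [show j + t + 1 - j - 1 = t by omega]
    push_cast
    ring
  simp only [preHilbertPoly, eval_smul, eval_comp, eval_add, eval_sub, eval_X, eval_C, eval_one, h]
  rw [ascPochhammer_eval_neg_coe_nat_of_lt (by omega), smul_zero]

/-- If `deg p < d`, then the coefficients of `p / (1 - X)ᵈ` agree with the values of the Hilbert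
polynomial from the start. -/
lemma coeff_mul_invOneSubPow_eq_eval {p : ℚ[X]} {d : ℕ} (hp : p.natDegree < d) (j : ℕ) :
    (p * PowerSeries.invOneSubPow ℚ d : PowerSeries ℚ).coeff j =
      (hilbertPoly p d).eval (j : ℚ) := by
  obtain ⟨e, rfl⟩ := Nat.exists_eq_add_of_lt hp
  set m := p.natDegree + e with hm
  have h1 : (hilbertPoly p (m + 1)).eval (j : ℚ) =
      ∑ i ∈ Finset.range (m + 1), if i ≤ j then p.coeff i * ((j - i + m).choose m : ℚ) else 0 := by
    rw [hilbertPoly_succ, eval_finsetSum]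
    rw [Finset.sum_subset (s₂ := Finset.range (m + 1))]
    · refine Finset.sum_congr rfl fun i hi => ?_
      rw [eval_smul, smul_eq_mul]
      split_ifs with h
      · rw [preHilbertPoly_eq_choose_sub_add _ _ h]
      · rw [eval_preHilbertPoly_eq_zero (by omega) (by simpa [Nat.lt_succ_iff] using hi), mul_zero]
    · intro i hi
      have := le_natDegree_of_mem_supp i hi
      exact Finset.mem_range.2 (by omega)
    · intro i _ hi
      rw [notMem_support_iff.1 hi, zero_smul, eval_zero]
  rw [h1, ← Finset.sum_filter, PowerSeries.coeff_mul,
    Finset.Nat.sum_antidiagonal_eq_sum_range_succ_mk,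
    PowerSeries.invOneSubPow_val_succ_eq_mk_add_choose]
  simp only [coeff_coe, PowerSeries.coeff_mk]
  symm
  refine Finset.sum_subset_zero_on_sdiff (fun i hi => ?_) (fun i hi => ?_) (fun i hi => ?_)
  · simp at hi ⊢
    omega
  · simp at hi
    rw [coeff_eq_zero_of_natDegree_lt (by omega), zero_mul]
  · rw [add_comm m]

/-- A backward difference is the forward difference read one step later; this is the source of the
arguments `r + l` in the formula. -/
lemma eval_iterate_backwardDiff (P : ℚ[X]) (l : ℕ) (x : ℚ) :
    (backwardDiff^[l] P).eval (x + l) = (fwdDiff 1)^[l] P.eval x := by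
  induction l generalizing P x with
  | zero => simp
  | succ l ih =>
    have h : (fun y => (backwardDiff P).eval (y + 1)) = fwdDiff 1 P.eval := by
      ext y
      simp [backwardDiff, fwdDiff]
    rw [Function.iterate_succ_apply, Function.iterate_succ_apply, ← h,
      fwdDiff_iter_comp_add 1 (fun y => (backwardDiff P).eval y), ← ih]
    congr 1
    push_cast
    ring

lemma eval_add_eq_sum_backwardDiff (P : ℚ[X]) {d : ℕ} (hP : P.natDegree < d) (x : ℚ) (j : ℕ) :
    P.eval (x + j) =
      ∑ l ∈ Finset.range d, (backwardDiff^[l] P).eval (x + l) * (j.choose l : ℚ) := by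
  have h := shift_eq_sum_fwdDiff_iter 1 P.eval j x
  rw [nsmul_one] at h
  rw [h]
  simp only [eval_iterate_backwardDiff, nsmul_eq_mul]
  -- The truncations at `j + 1` and at `d` agree with a common longer one: terms beyond `j` vanish
  -- by the binomial, terms from `d` on by the degree of `P`.
  have h1 : ∀ m, j + 1 ≤ m →
      ∑ l ∈ Finset.range (j + 1), (j.choose l : ℚ) * (fwdDiff 1)^[l] P.eval x =
        ∑ l ∈ Finset.range m, (j.choose l : ℚ) * (fwdDiff 1)^[l] P.eval x := fun m hm =>
    Finset.sum_subset (Finset.range_subset_range.2 hm) fun l _ hl => by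
      rw [Nat.choose_eq_zero_of_lt (by simpa using hl), Nat.cast_zero, zero_mul]
  have h2 : ∀ m, d ≤ m →
      ∑ l ∈ Finset.range d, (j.choose l : ℚ) * (fwdDiff 1)^[l] P.eval x =
        ∑ l ∈ Finset.range m, (j.choose l : ℚ) * (fwdDiff 1)^[l] P.eval x := fun m hm =>
    Finset.sum_subset (Finset.range_subset_range.2 hm) fun l _ hl => by
      rw [fwdDiff_iter_eq_zero_of_degree_lt (hP.trans_le (by simpa using hl)), Pi.zero_apply,
        mul_zero]
  rw [h1 (max (j + 1) d) (le_max_left _ _),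
    ← h2 (max (j + 1) d) (le_max_right _ _)]
  exact Finset.sum_congr rfl fun l _ => mul_comm _ _

/-- A polynomial with nonnegative values bounded by those of `E` at large naturals has degree at
most that of `E`. -/
lemma degree_le_of_eventually_le {T E : ℚ[X]} (h0 : ∀ᶠ j : ℕ in Filter.atTop, 0 ≤ T.eval (j : ℚ))
    (h1 : ∀ᶠ j : ℕ in Filter.atTop, T.eval (j : ℚ) ≤ E.eval (j : ℚ)) : T.degree ≤ E.degree := by
  by_contra! h
  have hT : T ≠ 0 := by
    rintro rfl
    simp at h
  have hcast : Filter.Tendsto (fun j : ℕ => (j : ℚ)) Filter.atTop Filter.atTop :=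
    tendsto_natCast_atTop_atTop
  have hlo := hcast.eventually ((isLittleO_atTop_of_degree_lt E T h).def (c := 1 / 2) (by norm_num))
  have hroot := hcast.eventually (eventually_atTop_not_isRoot T hT)
  obtain ⟨j, h0, h1, hlo, hroot⟩ := (h0.and (h1.and (hlo.and hroot))).exists
  rw [IsRoot] at hroot
  have hpos : 0 < T.eval (j : ℚ) := lt_of_le_of_ne h0 (Ne.symm hroot)
  have hn : ‖T.eval (j : ℚ)‖ ≤ ‖E.eval (j : ℚ)‖ := by
    have hE := h0.trans h1
    rw [← Rat.norm_cast_real, ← Rat.norm_cast_real, Real.norm_of_nonneg (by exact_mod_cast h0),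
      Real.norm_of_nonneg (by exact_mod_cast hE)]
    exact_mod_cast h1
  have : 0 < ‖T.eval (j : ℚ)‖ := norm_pos_iff.2 hroot
  linarith

/-- The Hilbert polynomial of `Q / (1 - X)^(n + 1)` has degree `n` minus the multiplicity of the
root 1 of `Q`. -/
lemma exists_eq_mul_one_sub_pow {Q : ℚ[X]} {n d : ℕ} (hQ : Q.natDegree < n) (hQ0 : Q ≠ 0)
    (hT : (hilbertPoly Q (n + 1)).natDegree ≤ d) :
    ∃ Q' : ℚ[X], Q = Q' * (1 - X) ^ (n - d) := by
  have hmult : Q.rootMultiplicity 1 < n + 1 := by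
    have := (rootMultiplicity_le_iff hQ0 1 n).2 (fun hdvd => by
      have := natDegree_le_of_dvd hdvd hQ0
      rw [natDegree_pow, natDegree_X_sub_C] at this
      omega)
    omega
  rw [natDegree_hilbertPoly_of_ne_zero_of_rootMultiplicity_lt hQ0 hmult] at hT
  obtain ⟨q, hq⟩ := (pow_dvd_pow (X - C (1 : ℚ)) (show n - d ≤ Q.rootMultiplicity 1 by omega)).trans
    (pow_rootMultiplicity_dvd Q 1)
  refine ⟨q * (-1) ^ (n - d), ?_⟩
  rw [mul_assoc, ← mul_pow, hq, mul_comm]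
  congr 2
  simp

lemma coeff_one_sub_X_pow (m i : ℕ) :
    PowerSeries.coeff i ((1 - PowerSeries.X : PowerSeries ℚ) ^ m) =
      (-1) ^ i * (m.choose i : ℚ) := by
  have h : ((1 - PowerSeries.X : PowerSeries ℚ) ^ m) =
      PowerSeries.rescale (-1 : ℚ) (((1 + X : ℚ[X]) ^ m : ℚ[X]) : PowerSeries ℚ) := by
    simp [PowerSeries.rescale_X, sub_eq_add_neg]
  rw [h, PowerSeries.coeff_rescale, coeff_coe, coeff_one_add_X_pow]

/-- The generating function of `H(j) = ∑ₗ (-1)ˡ βₗ dim R_{j-l}`. -/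
lemma exists_mk_eq_mul_invOneSubPow {n : ℕ} (hn : 0 < n) {β H : ℕ → ℚ}
    (hβ : ∀ i, n ≤ i → β i = 0)
    (hH : ∀ j, H j = ∑ l ∈ Finset.range (j + 1),
      (-1) ^ l * β l * ((n + (j - l) - 1).choose (j - l) : ℚ)) :
    ∃ Q : ℚ[X], (∀ l, Q.coeff l = (-1) ^ l * β l) ∧
      PowerSeries.mk H = (Q : PowerSeries ℚ) * PowerSeries.invOneSubPow ℚ n := by
  let Q : ℚ[X] := ∑ l ∈ Finset.range n, C ((-1) ^ l * β l) * X ^ l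
  have hQcoeff : ∀ l, Q.coeff l = (-1) ^ l * β l := by
    intro l
    simp only [Q, finsetSum_coeff, coeff_C_mul, coeff_X_pow, mul_ite, mul_one, mul_zero,
      Finset.sum_ite_eq, Finset.mem_range]
    split_ifs with h
    · rfl
    · rw [hβ l (by omega), mul_zero]
  refine ⟨Q, hQcoeff, ?_⟩
  ext j
  rw [PowerSeries.coeff_mk, PowerSeries.coeff_mul,
    Finset.Nat.sum_antidiagonal_eq_sum_range_succ_mk,
    PowerSeries.invOneSubPow_val_eq_mk_sub_one_add_choose_of_pos _ _ hn, hH]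
  refine Finset.sum_congr rfl fun l _ => ?_
  simp only [coeff_coe, PowerSeries.coeff_mk, hQcoeff]
  rw [show n + (j - l) - 1 = n - 1 + (j - l) by omega, Nat.choose_symm_add]

/-- If only finitely many `βₗ` do not vanish, then `H(j) = ∑ₗ (-1)ˡ βₗ dim R_{j-l}` is eventually
polynomial. -/
lemma exists_eventually_eq_eval {n : ℕ} (hn : 0 < n) {β H : ℕ → ℚ}
    (hβ : ∀ i, n ≤ i → β i = 0)
    (hH : ∀ j, H j = ∑ l ∈ Finset.range (j + 1),
      (-1) ^ l * β l * ((n + (j - l) - 1).choose (j - l) : ℚ)) :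
    ∃ P : ℚ[X], ∀ᶠ j : ℕ in Filter.atTop, P.eval (j : ℚ) = H j := by
  obtain ⟨Q, -, hQ⟩ := exists_mk_eq_mul_invOneSubPow hn hβ hH
  refine ⟨hilbertPoly Q n, ?_⟩
  filter_upwards [Filter.eventually_gt_atTop Q.natDegree] with j hj
  rw [← coeff_mul_invOneSubPow_eq_hilbertPoly_eval _ hj, ← hQ, PowerSeries.coeff_mk]

/-- Inversion of `H(j) = ∑ₗ (-1)ˡ βₗ dim R_{j-l}` in terms of the Hilbert polynomial. -/
theorem betti_eq_of_hilbertFunction {n d : ℕ} (hdn : d ≤ n) {β H : ℕ → ℚ} {P : ℚ[X]} (r : ℚ)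
    (hβ : ∀ i, n ≤ i → β i = 0) (hβ0 : β 0 ≠ 0) (hH0 : ∀ j, 0 ≤ H j)
    (hH : ∀ j, H j = ∑ l ∈ Finset.range (j + 1),
      (-1) ^ l * β l * ((n + (j - l) - 1).choose (j - l) : ℚ))
    (hP : ∀ᶠ j : ℕ in Filter.atTop, P.eval (r + j) = H j)
    (hgrowth : ∃ E : ℚ[X], E.natDegree ≤ d ∧
      ∀ j : ℕ, ∑ i ∈ Finset.range (j + 1), H i ≤ E.eval (j : ℚ)) (i : ℕ) :
    β i = ∑ l ∈ Finset.range (min i (d - 1) + 1), (-1) ^ l * ((n - l - 1).choose (i - l) : ℚ) *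
      (backwardDiff^[l] P).eval (r + l) := by
  have hn : 0 < n := Nat.pos_of_ne_zero fun h => hβ0 (hβ 0 (by omega))
  obtain ⟨Q, hQcoeff, hseries⟩ := exists_mk_eq_mul_invOneSubPow hn hβ hH
  have hQ0 : Q ≠ 0 := fun h => hβ0 (by simpa [h] using (hQcoeff 0).symm)
  have hQdeg : Q.natDegree < n := by
    rw [natDegree_lt_iff_degree_lt hQ0, degree_lt_iff_coeff_zero]
    intro m hm
    rw [hQcoeff, hβ m hm, mul_zero]
  -- `Q / (1 - X)^(n + 1)` generates the partial sums of `H`, to which the growth bound applies.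
  have hT : (hilbertPoly Q (n + 1)).natDegree ≤ d := by
    obtain ⟨E, hE, hle⟩ := hgrowth
    have hsum : ∀ᶠ j : ℕ in Filter.atTop,
        (hilbertPoly Q (n + 1)).eval (j : ℚ) = ∑ i ∈ Finset.range (j + 1), H i := by
      filter_upwards [Filter.eventually_gt_atTop Q.natDegree] with j hj
      rw [← coeff_mul_invOneSubPow_eq_hilbertPoly_eval _ hj, PowerSeries.invOneSubPow_add,
        Units.val_mul, ← mul_assoc, ← hseries, PowerSeries.coeff_mul,
        Finset.Nat.sum_antidiagonal_eq_sum_range_succ_mk,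
        PowerSeries.invOneSubPow_val_eq_mk_sub_one_add_choose_of_pos ℚ 1 one_pos]
      simp
    refine (natDegree_le_natDegree (degree_le_of_eventually_le ?_ ?_)).trans hE
    · filter_upwards [hsum] with j hj
      rw [hj]
      exact Finset.sum_nonneg fun i _ => hH0 i
    · filter_upwards [hsum] with j hj
      rw [hj]
      exact hle j
  obtain ⟨Q', hQ'⟩ := exists_eq_mul_one_sub_pow hQdeg hQ0 hT
  have hQ'0 : Q' ≠ 0 := by
    rintro rfl
    exact hQ0 (by rw [hQ', zero_mul])
  have h1X : ((1 : ℚ[X]) - X).natDegree = 1 := by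
    rw [← natDegree_neg, neg_sub, ← C_1, natDegree_X_sub_C]
  -- From `deg Q < n` and the factor `(1 - X)^(n - d)`; in particular `d = 0` is impossible.
  have hQ'deg : Q'.natDegree < d := by
    have h1X0 : ((1 : ℚ[X]) - X) ≠ 0 := fun h => by simp [h] at h1X
    have := congrArg natDegree hQ'
    rw [natDegree_mul hQ'0 (pow_ne_zero _ h1X0), natDegree_pow, h1X] at this
    omega
  have hseries' : PowerSeries.mk H = (Q' : PowerSeries ℚ) * PowerSeries.invOneSubPow ℚ d := by
    rw [hseries, hQ', Polynomial.coe_mul, mul_assoc]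
    congr 1
    have := PowerSeries.one_sub_pow_mul_invOneSubPow_val_add_eq_invOneSubPow_val ℚ d (n - d)
    rw [Nat.add_sub_cancel' hdn] at this
    simpa using this
  -- Since `deg Q' < d`, agreement holds for every `j`, not only for large ones.
  have hHeval : ∀ j, H j = (hilbertPoly Q' d).eval (j : ℚ) := by
    intro j
    rw [← coeff_mul_invOneSubPow_eq_eval hQ'deg, ← hseries', PowerSeries.coeff_mk]
  have hPcomp : P.comp (X + C r) = hilbertPoly Q' d := by
    obtain ⟨N, hN⟩ := Filter.eventually_atTop.1 hP
    refine eq_of_infinite_eval_eq _ _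
      (((Set.Ici_infinite N).image Nat.cast_injective.injOn).mono ?_)
    rintro _ ⟨j, hj, rfl⟩
    change (P.comp (X + C r)).eval (j : ℚ) = (hilbertPoly Q' d).eval (j : ℚ)
    rw [← hHeval, ← hN j hj]
    simp [add_comm]
  have hPeval : ∀ j : ℕ, H j = P.eval (r + j) := by
    intro j
    rw [hHeval, ← hPcomp]
    simp [add_comm]
  have hPdeg : P.natDegree < d := by
    have h := congrArg natDegree hPcomp
    rw [natDegree_comp, natDegree_X_add_C, mul_one] at h
    rw [h]
    by_cases h0 : hilbertPoly Q' d = 0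
    · rw [h0, natDegree_zero]
      omega
    · rw [natDegree_hilbertPoly_of_ne_zero h0]
      omega
  set b : ℕ → ℚ := fun l => (backwardDiff^[l] P).eval (r + l) with hb
  have hnewton : PowerSeries.mk H = ∑ l ∈ Finset.range d,
      PowerSeries.C (b l) * (PowerSeries.X ^ l *
        (PowerSeries.invOneSubPow ℚ (l + 1) : PowerSeries ℚ)) := by
    ext j
    rw [PowerSeries.coeff_mk, hPeval, eval_add_eq_sum_backwardDiff P hPdeg, map_sum]
    refine Finset.sum_congr rfl fun l _ => ?_
    rw [PowerSeries.coeff_C_mul, PowerSeries.coeff_X_pow_mul',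
      PowerSeries.invOneSubPow_val_succ_eq_mk_add_choose]
    split_ifs with h
    · rw [PowerSeries.coeff_mk, Nat.add_sub_cancel' h]
    · rw [Nat.choose_eq_zero_of_lt (by omega), Nat.cast_zero]
  have hQser : (Q : PowerSeries ℚ) = ∑ l ∈ Finset.range d,
      PowerSeries.C (b l) * (PowerSeries.X ^ l * (1 - PowerSeries.X) ^ (n - l - 1)) := by
    have h1 : (Q : PowerSeries ℚ) = (1 - PowerSeries.X) ^ n * PowerSeries.mk H := by
      rw [hseries, mul_comm, mul_assoc, ← PowerSeries.invOneSubPow_inv_eq_one_sub_pow,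
        Units.val_inv, mul_one]
    rw [h1, hnewton, Finset.mul_sum]
    refine Finset.sum_congr rfl fun l hl => ?_
    have hl' : l < d := Finset.mem_range.1 hl
    have := PowerSeries.one_sub_pow_add_mul_invOneSubPow_val_eq_one_sub_pow ℚ (n - l - 1) (l + 1)
    rw [show n - l - 1 + (l + 1) = n by omega] at this
    rw [← this]
    ring
  have hcoef := congrArg (PowerSeries.coeff i) hQser
  rw [coeff_coe, hQcoeff, map_sum] at hcoef
  have hsq : ((-1 : ℚ) ^ i) * (-1) ^ i = 1 := by rw [← mul_pow]; simp
  have hβi : β i = (-1) ^ i * ((-1) ^ i * β i) := by rw [← mul_assoc, hsq, one_mul]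
  -- Here `d > 0`, by `hPdeg`, so `d - 1` is not truncated.
  have hrange : Finset.range (min i (d - 1) + 1) = (Finset.range d).filter (· ≤ i) := by
    ext l
    simp
    omega
  rw [hβi, hcoef, hrange, Finset.sum_filter, Finset.mul_sum]
  refine Finset.sum_congr rfl fun l _ => ?_
  rw [PowerSeries.coeff_C_mul, PowerSeries.coeff_X_pow_mul']
  split_ifs with h
  · rw [coeff_one_sub_X_pow]
    obtain ⟨t, rfl⟩ := Nat.exists_eq_add_of_le h
    rw [Nat.add_sub_cancel_left]
    have ht : ((-1 : ℚ) ^ t) * (-1) ^ t = 1 := by rw [← mul_pow]; simp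
    rw [pow_add]
    linear_combination ((-1) ^ l * b l * ((n - l - 1).choose t : ℚ)) * ht
  · simp

end Numerics
end LinearResolution

/-! ### Assembly -/

theorem mainTheorem8 {k : Type u} [Field k] (n : ℕ)
    {M : Type u} [AddCommGroup M] [Module k M] [Module (MvPolynomial (Fin n) k) M]
    [IsScalarTower k (MvPolynomial (Fin n) k) M] [Module.Finite (MvPolynomial (Fin n) k) M]
    (𝓜 : ℤ → Submodule k M) (h𝓜 : LinearResolution.IsGradedModule (n := n) 𝓜)
    (d : ℕ) (hd : Module.supportDim (MvPolynomial (Fin n) k) M = (d : WithBot ℕ∞))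
    (r : ℤ) (hreg : LinearResolution.HasRegularity n 𝓜 r)
    (hindeg : LinearResolution.HasInitialDegree 𝓜 r)
    (hH0 : LinearResolution.zerothLocalCohomology k n M = ⊥) (i : ℕ) :
    Module.Finite k (LinearResolution.torResidueField k n M i) ∧
    (Module.finrank k (LinearResolution.torResidueField k n M i) : ℚ) =
      ∑ l ∈ Finset.range (min i (d - 1) + 1),
        (-1 : ℚ) ^ l * (Nat.choose (n - l - 1) (i - l) : ℚ) *
          (LinearResolution.backwardDiff^[l] (LinearResolution.hilbertPolynomial 𝓜)).eval
            ((r + (l : ℤ) : ℤ) : ℚ) := by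
  obtain ⟨F, hF⟩ := hreg
  have hlin : F.IsLinear r := F.deg_eq hindeg hF
  obtain ⟨hfin, hrank⟩ := F.finrank_torResidueField i
  refine ⟨hfin, ?_⟩
  rw [hrank]
  have hr : 𝓜 r ≠ ⊥ := hindeg.1
  obtain ⟨x, -, hx⟩ := (Submodule.ne_bot_iff _).1 hr
  have : Nontrivial M := ⟨x, 0, hx⟩
  have hβ : ∀ i, n ≤ i → ((F.rank i : ℕ) : ℚ) = 0 := fun i hi => by
    rw [hlin.rank_eq_zero hH0 hi, Nat.cast_zero]
  have hβ0 : ((F.rank 0 : ℕ) : ℚ) ≠ 0 := by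
    rw [← hlin.hilbertFunction_zero h𝓜]
    have := hlin.finite_component h𝓜 0
    rw [Nat.cast_zero, add_zero] at this
    rw [LinearResolution.hilbertFunction, Nat.cast_ne_zero]
    exact fun h => hr (Submodule.finrank_eq_zero.1 h)
  have hdn : d ≤ n := by
    have h := Module.supportDim_le_ringKrullDim (MvPolynomial (Fin n) k) M
    rw [hd, MvPolynomial.ringKrullDim_of_isNoetherianRing, ringKrullDim_eq_zero_of_field] at h
    simp only [Nat.card_eq_fintype_card, Fintype.card_fin, zero_add] at h
    exact_mod_cast h
  have hn : 0 < n := Nat.pos_of_ne_zero fun h => hβ0 (hβ 0 (by omega))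
  have hex : ∃ P, LinearResolution.IsHilbertPolynomial 𝓜 P := by
    obtain ⟨P, hP⟩ := LinearResolution.exists_eventually_eq_eval hn hβ (hlin.hilbertFunction_eq h𝓜)
    obtain ⟨N, hN⟩ := Filter.eventually_atTop.1 hP
    -- The numerical lemma counts degrees from `r`, hence the shift.
    refine ⟨P.comp (Polynomial.X - Polynomial.C (r : ℚ)), ?_⟩
    filter_upwards [Filter.eventually_ge_atTop (r + N)] with t ht
    obtain ⟨j, rfl⟩ : ∃ j : ℕ, t = r + j := ⟨(t - r).toNat, by omega⟩
    rw [← hN j (by omega)]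
    simp
  have hP : LinearResolution.IsHilbertPolynomial 𝓜 (LinearResolution.hilbertPolynomial 𝓜) := by
    rw [LinearResolution.hilbertPolynomial, dif_pos hex]
    exact hex.choose_spec
  have key := LinearResolution.betti_eq_of_hilbertFunction hdn
    (β := fun i => (F.rank i : ℚ)) (H := fun j => (LinearResolution.hilbertFunction 𝓜 (r + j) : ℚ))
    (P := LinearResolution.hilbertPolynomial 𝓜) (r := (r : ℚ)) hβ hβ0
    (fun j => Nat.cast_nonneg _) (hlin.hilbertFunction_eq h𝓜) ?_ ?_ i
  · rw [key]
    push_cast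
    rfl
  · have h := (Filter.tendsto_atTop_add_const_left Filter.atTop r
      (tendsto_natCast_atTop_atTop (R := ℤ))).eventually hP
    filter_upwards [h] with j hj
    simpa using hj
  · obtain ⟨s, q, c, D, hs, hle⟩ := hlin.exists_sum_hilbertFunction_le h𝓜
    rw [hd] at hs
    refine ⟨Polynomial.C (q : ℚ) * (Polynomial.C (D : ℚ) * Polynomial.X +
      Polynomial.C ((c + 1 : ℕ) : ℚ)) ^ s, ?_, fun j => ?_⟩
    · refine (Polynomial.natDegree_C_mul_le _ _).trans (Polynomial.natDegree_pow_le.trans ?_)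
      have hsd : s ≤ d := by exact_mod_cast hs
      calc _ ≤ s * 1 := Nat.mul_le_mul_left _ Polynomial.natDegree_linear_le
        _ ≤ d := by omega
    · have := hle j
      rw [← @Nat.cast_le ℚ] at this
      push_cast at this
      refine this.trans (le_of_eq ?_)
      simp only [Polynomial.eval_mul, Polynomial.eval_pow, Polynomial.eval_add, Polynomial.eval_C,
        Polynomial.eval_X]
      push_cast
      ring
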